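/- Let $f:[0,1]\to\mathbb R$ be differentiable with absolutely continuous derivative, $f'(t)-f'(0)=\int_0^t f''(u)\,du$, and $\int_0^1 f''(u)^2\,du<\infty$. Let $\sigma>0$ and, for each $n$, let $Y_i=Y(t_i)=f(t_i)+\sigma Z(t_i)$ with $t_i=i/n$, $1\le i\le n$, and $Z(t_1),\dots,Z(t_n)$ i.i.d. standard Gaussian. Write $R(g)=\int_0^1 g''(t)^2\,dt$ for functions $g$ on $[0,1]$ with absolutely continuous first derivative and square-integrable second derivative. *Confidence region.* Let $\mathcal I_n$ be the dyadic family of the non-empty index sets $\{m2^k+1,\dots,\min((m+1)2^k,n)\}$, $k,m\ge 0$; let $w(I,g)=|I|^{-1/2}\sum_{i\in I}(Y_i-g(t_i))$; let $\sigma_n=\frac{1.4826}{\sqrt2}\,\mathrm{median}\{|Y_i-Y_{i-1}|: i=2,\dots,n-1\}$; and let $$\mathcal A_n=\Big\{g:\ \max_{I\in\mathcal I_n}|w(I,g)|\le\sigma_n\sqrt{3\log n}\Big\}.$$ *Splines.* For positive weights $\lambda=(\lambda_1,\dots,\lambda_n)$ let $\tilde f_n(\lambda)$ be the minimizer of $\sum_{i=1}^n\lambda_i(Y_i-g(t_i))^2+R(g)$.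 For a scalar $\lambda>0$ let $\tilde f_n(\lambda)$ denote the minimizer with all weights equal to $\lambda$, and let $\tilde f_n(0)$ be its limit as $\lambda\downarrow 0$, the least squares line. *Weighted procedure.* Fix $q>1$ and an arbitrary initial weight $\lambda_1>0$ (which may depend on $n$ and on the data). If the least squares line lies in $\mathcal A_n$, accept it. Otherwise start with all weights equal to $\lambda_1$; as long as the spline $\tilde f_n(\lambda)$ for the current weight vector $\lambda$ is not in $\mathcal A_n$, multiply by $q$ the weights $\lambda_j$ of all points $t_j$ lying in some $I\in\mathcal I_n$ with $|w(I,\tilde f_n(\lambda))|\ge\sigma_n\sqrt{3\log n}$; accept the first spline that lies in $\mathcal A_n$. *Equal-weight procedure.* Let $\lambda_n^*$ be the smallest $\lambda\ge0$ with $\tilde f_n(\lambda)\in\mathcal A_n$, and take $\tilde f_n(\lambda_n^*)$. Let $f_n^*$ be the function accepted by the weighted procedure if its roughness $R$ is at most $R(\tilde f_n(\lambda_n^*))$, and $f_n^*=\tilde f_n(\lambda_n^*)$ otherwise. If $(\delta_n)$ is a sequence of real numbers such that $\lim_{n\to\infty}\delta_n n^{5/16}(\log n)^{-9/16}=\infty$,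 then $$\sup_{\delta_n\le t\le 1-\delta_n}|f_n^*(t)-f(t)|=O_P\big((\log n)^{7/32}n^{-11/32}\big),$$ that is, for every $\varepsilon>0$ there is $M$ such that for all sufficiently large $n$ the probability that the supremum exceeds $M(\log n)^{7/32}n^{-11/32}$ is at most $\varepsilon$. -/

import Mathlib

open MeasureTheory ProbabilityTheory Filter Topology Set
open scoped ENNReal

noncomputable section

namespace WSpline

/-! Functions on the unit interval with a square-integrable second derivative.
Functions are total on the real line; only their values on the unit interval matter. -/

/-- `h` is the (almost everywhere defined) second derivative of `g` on the unit interval: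
`g` is differentiable there, with derivative `g₁` (one-sided at the end points), one has
`g₁ t - g₁ 0 = ∫₀ᵗ h`, and `h` is square integrable. -/
def HasSecondDeriv (g h : ℝ → ℝ) : Prop :=
  MemLp h 2 (volume.restrict (Icc (0 : ℝ) 1)) ∧
    ∃ g₁ : ℝ → ℝ, (∀ t ∈ Icc (0 : ℝ) 1, HasDerivWithinAt g (g₁ t) (Icc 0 1) t) ∧
      ∀ t ∈ Icc (0 : ℝ) 1, g₁ t - g₁ 0 = ∫ u in (0 : ℝ)..t, h u

/-- `g` has an absolutely continuous first derivative on the unit interval, and the second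
derivative is square integrable. -/
def MemH2 (g : ℝ → ℝ) : Prop := ∃ h, HasSecondDeriv g h

/-- The roughness `∫₀¹ g''(t)² dt`. -/
def roughness (g : ℝ → ℝ) : ℝ :=
  ∫ t in (0 : ℝ)..1, (derivWithin (derivWithin g (Icc 0 1)) (Icc 0 1) t) ^ 2

/-! The data at sample size `n` are a function `y : ℕ → ℝ`, of which only the values `y i` with
`1 ≤ i ≤ n` are used; `y i` is the observation at the design point `i / n`. -/

/-- The design points. -/
def design (n i : ℕ) : ℝ := (i : ℝ) / n

/-- `∑ λᵢ (yᵢ - g(tᵢ))² + ∫₀¹ g''²`. -/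
def splineObjective (n : ℕ) (lam y : ℕ → ℝ) (g : ℝ → ℝ) : ℝ :=
  ∑ i ∈ Finset.Icc 1 n, lam i * (y i - g (design n i)) ^ 2 + roughness g

/-- `g` solves the weighted smoothing spline problem with weights `lam`. -/
def IsWeightedSpline (n : ℕ) (lam y : ℕ → ℝ) (g : ℝ → ℝ) : Prop :=
  MemH2 g ∧ ∀ h, MemH2 h → splineObjective n lam y g ≤ splineObjective n lam y h

/-- The weighted smoothing spline. For `n ≥ 2` and positive weights the solution exists
and is unique on the unit interval. -/
def weightedSpline (n : ℕ) (lam y : ℕ → ℝ) : ℝ → ℝ :=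
  Classical.epsilon (IsWeightedSpline n lam y)

/-- `t ↦ p.1 + p.2 * t` is a least squares line through the data. -/
def IsLeastSquares (n : ℕ) (y : ℕ → ℝ) (p : ℝ × ℝ) : Prop :=
  ∀ p' : ℝ × ℝ, ∑ i ∈ Finset.Icc 1 n, (y i - (p.1 + p.2 * design n i)) ^ 2 ≤
    ∑ i ∈ Finset.Icc 1 n, (y i - (p'.1 + p'.2 * design n i)) ^ 2

/-- The least squares line. -/
def lsLine (n : ℕ) (y : ℕ → ℝ) (t : ℝ) : ℝ :=
  (Classical.epsilon (IsLeastSquares n y)).1 + (Classical.epsilon (IsLeastSquares n y)).2 * t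

/-! The confidence region. -/

/-- The dyadic intervals `{m 2ᵏ + 1, …, (m + 1) 2ᵏ}` of indices, cut off at `n`. -/
def block (n k m : ℕ) : Finset ℕ := Finset.Ioc (m * 2 ^ k) (min ((m + 1) * 2 ^ k) n)

/-- The normalized sum of residuals over a set `I` of indices. -/
def resid (n : ℕ) (y : ℕ → ℝ) (I : Finset ℕ) (g : ℝ → ℝ) : ℝ :=
  (∑ i ∈ I, (y i - g (design n i))) / √(I.card : ℝ)

/-- The median: the middle order statistic, or the mean of the two middle ones. -/
def median (s : Multiset ℝ) : ℝ :=
  ((s.sort (· ≤ ·)).getD ((s.card - 1) / 2) 0 + (s.sort (· ≤ ·)).getD (s.card / 2) 0) / 2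

/-- The scale estimate `(1.4826 / √2) · MED {|y(tᵢ) - y(tᵢ₋₁)| : i = 2, …, n - 1}`. -/
def scaleEst (n : ℕ) (y : ℕ → ℝ) : ℝ :=
  1.4826 / √2 * median ((Finset.Icc 2 (n - 1)).val.map fun i => |y i - y (i - 1)|)

/-- The bound `σₙ √(3 log n)`. -/
def threshold (n : ℕ) (y : ℕ → ℝ) : ℝ := scaleEst n y * √(3 * Real.log n)

/-- The region `𝒜ₙ` for the dyadic scheme, with `τₙ = 3`. Empty blocks give no condition on `g`
beyond `0 ≤ threshold n y`, which always holds. -/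
def region (n : ℕ) (y : ℕ → ℝ) : Set (ℝ → ℝ) :=
  {g | ∀ k m : ℕ, |resid n y (block n k m) g| ≤ threshold n y}

/-! First procedure: locally chosen weights. -/

open Classical in
/-- The weights at the successive stages: all equal to `l` at first; afterwards the weights of
the points in those intervals on which the residuals are too large are multiplied by `q`. -/
def weightSeq (q l : ℝ) (n : ℕ) (y : ℕ → ℝ) : ℕ → ℕ → ℝ
  | 0 => fun _ => l
  | j + 1 => fun i =>
      if ∃ k m : ℕ, i ∈ block n k m ∧
          threshold n y ≤ |resid n y (block n k m) (weightedSpline n (weightSeq q l n y j) y)|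
      then q * weightSeq q l n y j i else weightSeq q l n y j i

open Classical in
/-- The least squares line if it lies in the region; otherwise the weighted smoothing spline at
the first stage at which it lies in the region. -/
def weightedFit (q l : ℝ) (n : ℕ) (y : ℕ → ℝ) : ℝ → ℝ :=
  if lsLine n y ∈ region n y then lsLine n y
  else weightedSpline n
    (weightSeq q l n y (sInf {j | weightedSpline n (weightSeq q l n y j) y ∈ region n y})) y

/-! Second procedure: equal weights. -/

open Classical in
/-- The smoothing spline with all weights equal to `lam`; for `lam = 0` this is read as its limit
as the weight tends to zero, the least squares line. -/
def equalSpline (n : ℕ) (y : ℕ → ℝ) (lam : ℝ) : ℝ → ℝ :=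
  if lam = 0 then lsLine n y else weightedSpline n (fun _ => lam) y

/-- The equal-weight spline for the smallest `lam ≥ 0` for which it lies in the region. -/
def equalFit (n : ℕ) (y : ℕ → ℝ) : ℝ → ℝ :=
  equalSpline n y
    (Classical.epsilon (IsLeast {lam : ℝ | 0 ≤ lam ∧ equalSpline n y lam ∈ region n y}))

open Classical in
/-- The estimate of the modified procedure: the result of the first procedure if it is at least as
smooth as that of the second one, otherwise the result of the second one. (Membership in the
region says that the first procedure has come to a stop.) -/
def modifiedEstimate (q l : ℝ) (n : ℕ) (y : ℕ → ℝ) : ℝ → ℝ :=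
  if weightedFit q l n y ∈ region n y ∧
      roughness (weightedFit q l n y) ≤ roughness (equalFit n y)
  then weightedFit q l n y else equalFit n y

/-! Stochastic order. -/

/-- `X n = O_P(r n)` for random variables with values in `[0, ∞]`. For sets that are not
measurable, `μ` is the outer measure. -/
def IsBigOP {Ω : Type*} [MeasurableSpace Ω] (μ : Measure Ω) (X : ℕ → Ω → ℝ≥0∞) (r : ℕ → ℝ) :
    Prop :=
  ∀ ε : ℝ, 0 < ε → ∃ M : ℝ, 0 < M ∧
    ∀ᶠ n : ℕ in atTop, μ {ω | ENNReal.ofReal (M * r n) < X n ω} ≤ ENNReal.ofReal ε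

end WSpline

end

/-!
# Sup-norm rate of a smoothing spline selected by multiresolution residual bounds

Let `L = log n`. Two facts carry the proof.

*Functions in the region are close to each other in the interior.* If `g` and `f` both have small
residual sums over dyadic blocks and `u = g - f`, then by Taylor's formula with remainder
`d^{3/2} R(u)^{1/2}` at `t`, the sum of `u` over the nearest full block on the side of `t` to which
the tangent moves away from zero dominates `2ᵏ |u(t)|`, up to the remainder
(`abs_le_of_block_sums`). Hence
`|u(t)| ≲ (L / 2ᵏ)^{1/2} + (2ᵏ / n)^{3/2} R(u)^{1/2}`, at distance at least `2 · 2ᵏ / n` from the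
end points.

*The selected function has roughness `O_P(n^{1/4} L^{-5/4})`.* It is at most as rough as the
equal-weight spline with the smallest admissible weight, whose roughness increases with the weight,
so it is enough that the spline with weight `c / L` is admissible and has roughness of this order.
That spline splits linearly into a part for `f` and a part for the noise (`equalSpline_mem_region`).
Comparison with `f` bounds the bias of the first part in the Euclidean norm by `(R(f) L / c)^{1/2}`
and its roughness by `R(f)`. For the second part the normal equations show that the smoother matrix
is symmetric and the residuals are a contraction of the data, so that normalized residual sums are
Gaussian with variance at most one (`sum_sq_residCoeff_le`), and a union bound over the blocks
gives the bound `1.5 L^{1/2}`. Its mean roughness is the sum of the roughnesses of the splines for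
the unit vectors, which a discrete Sobolev inequality (`sq_design_le`) controls through the diagonal
of the smoother matrix (`basisSpline_diag_le`).

Since `0.9 √3 > 1.5 + 0.05`, it suffices that the scale estimate exceeds `0.9 σ`; this follows from
Chebyshev's inequality for the `1`-dependent differences, the density of `N(0, 2)` being small
enough (`IsGaussianNoise.measure_scaleEst_lt`). The block length `2ᵏ ≈ n^{11/16} L^{9/16}` balances
the two terms of the first bound.

That the smallest admissible weight exists needs right-continuity of the fitted values in the
weight, down to the least squares line at weight zero (`exists_isLeast`), and that splines exist at all
is orthogonal projection in `ℝⁿ × L²(0, 1)` (`exists_isWeightedSpline`).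
-/

noncomputable section

namespace WSpline

/-! ### Functions with a square-integrable second derivative -/

section SecondDeriv

variable {g φ h k : ℝ → ℝ}

lemma memLp_intervalIntegrable (hh : MemLp h 2 (volume.restrict (Icc (0 : ℝ) 1))) {a b : ℝ}
    (ha : a ∈ Icc (0 : ℝ) 1) (hb : b ∈ Icc (0 : ℝ) 1) : IntervalIntegrable h volume a b := by
  have h1 : IntegrableOn h (Icc (0 : ℝ) 1) volume := hh.integrable (by norm_num)
  have h2 : IntervalIntegrable h volume 0 1 :=
    (intervalIntegrable_iff_integrableOn_Icc_of_le zero_le_one).2 h1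
  refine h2.mono_set ?_
  rw [uIcc_of_le (zero_le_one' ℝ)]
  exact Set.uIcc_subset_Icc ha hb

lemma memLp_mul_intervalIntegrable (hh : MemLp h 2 (volume.restrict (Icc (0 : ℝ) 1)))
    (hk : MemLp k 2 (volume.restrict (Icc (0 : ℝ) 1))) {a b : ℝ}
    (ha : a ∈ Icc (0 : ℝ) 1) (hb : b ∈ Icc (0 : ℝ) 1) :
    IntervalIntegrable (fun t => h t * k t) volume a b := by
  have h1 : IntegrableOn (fun t => h t * k t) (Icc (0 : ℝ) 1) volume := hh.integrable_mul hk
  have h2 : IntervalIntegrable (fun t => h t * k t) volume 0 1 :=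
    (intervalIntegrable_iff_integrableOn_Icc_of_le zero_le_one).2 h1
  refine h2.mono_set ?_
  rw [uIcc_of_le (zero_le_one' ℝ)]
  exact Set.uIcc_subset_Icc ha hb

lemma HasSecondDeriv.add (hg : HasSecondDeriv g h) (hφ : HasSecondDeriv φ k) :
    HasSecondDeriv (fun t => g t + φ t) (fun t => h t + k t) := by
  obtain ⟨hh, g₁, hg₁, hgi⟩ := hg
  obtain ⟨hk, φ₁, hφ₁, hφi⟩ := hφ
  refine ⟨hh.add hk, fun t => g₁ t + φ₁ t, fun t ht => (hg₁ t ht).add (hφ₁ t ht), fun t ht => ?_⟩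
  rw [intervalIntegral.integral_add (memLp_intervalIntegrable hh (by simp) ht)
    (memLp_intervalIntegrable hk (by simp) ht), ← hgi t ht, ← hφi t ht]
  ring

lemma HasSecondDeriv.const_mul (hg : HasSecondDeriv g h) (c : ℝ) :
    HasSecondDeriv (fun t => c * g t) (fun t => c * h t) := by
  obtain ⟨hh, g₁, hg₁, hgi⟩ := hg
  refine ⟨hh.const_mul c, fun t => c * g₁ t, fun t ht => (hg₁ t ht).const_mul c, fun t ht => ?_⟩
  rw [intervalIntegral.integral_const_mul, ← hgi t ht]
  ring

lemma hasSecondDeriv_affine (a b : ℝ) :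
    HasSecondDeriv (fun t => a + b * t) (fun _ => 0) := by
  refine ⟨MemLp.zero', fun _ => b, fun t _ => ?_, fun t _ => by simp⟩
  simpa using (((hasDerivAt_id t).const_mul b).const_add a).hasDerivWithinAt

lemma HasSecondDeriv.sum {ι : Type*} (s : Finset ι) (c : ι → ℝ) {G H : ι → ℝ → ℝ}
    (hG : ∀ i ∈ s, HasSecondDeriv (G i) (H i)) :
    HasSecondDeriv (fun t => ∑ i ∈ s, c i * G i t) (fun t => ∑ i ∈ s, c i * H i t) := by
  classical
  induction s using Finset.induction_on with
  | empty => simpa using hasSecondDeriv_affine 0 0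
  | insert a s ha ih =>
    simp only [Finset.sum_insert ha]
    exact ((hG a (by simp)).const_mul (c a)).add (ih fun i hi => hG i (by simp [hi]))

lemma HasSecondDeriv.sub (hg : HasSecondDeriv g h) (hφ : HasSecondDeriv φ k) :
    HasSecondDeriv (fun t => g t - φ t) (fun t => h t - k t) := by
  simpa [sub_eq_add_neg] using hg.add (hφ.const_mul (-1))

/-- The roughness is the energy of any version of the second derivative. -/
lemma HasSecondDeriv.roughness_eq (hg : HasSecondDeriv g h) :
    roughness g = ∫ t in (0 : ℝ)..1, h t ^ 2 := by
  obtain ⟨hh, g₁, hg₁, hgi⟩ := hg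
  have hint : IntervalIntegrable h volume 0 1 :=
    memLp_intervalIntegrable hh (by simp) (by simp)
  have hae := hint.ae_hasDerivAt_integral
  have hD : ∀ t ∈ Icc (0 : ℝ) 1, derivWithin g (Icc 0 1) t = g₁ t := fun t ht =>
    (hg₁ t ht).derivWithin (uniqueDiffOn_Icc zero_lt_one t ht)
  have hone : ∀ᵐ t : ℝ, t ≠ 1 := by simp [ae_iff]
  refine intervalIntegral.integral_congr_ae ?_
  filter_upwards [hae, hone] with t ht ht1 hmem
  rw [uIoc_of_le zero_le_one] at hmem
  have hmem' : t ∈ Icc (0 : ℝ) 1 := ⟨hmem.1.le, hmem.2⟩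
  have h3 := ht (by rwa [uIcc_of_le (zero_le_one' ℝ)]) 0 (by simp)
  have h4 : HasDerivWithinAt (derivWithin g (Icc 0 1)) (h t) (Icc 0 1) t := by
    refine ((h3.const_add (g₁ 0)).hasDerivWithinAt).congr (fun s hs => ?_) ?_
    · rw [hD s hs, ← hgi s hs]; ring
    · rw [hD t hmem', ← hgi t hmem']; ring
  rw [h4.derivWithin (uniqueDiffOn_Icc zero_lt_one t hmem')]

lemma roughness_nonneg (g : ℝ → ℝ) : 0 ≤ roughness g :=
  intervalIntegral.integral_nonneg zero_le_one fun _ _ => sq_nonneg _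

lemma MemH2.const_mul (hg : MemH2 g) (c : ℝ) : MemH2 (fun t => c * g t) := by
  obtain ⟨h, hh⟩ := hg
  exact ⟨_, hh.const_mul c⟩

lemma MemH2.sub (hg : MemH2 g) (hφ : MemH2 φ) : MemH2 (fun t => g t - φ t) := by
  obtain ⟨h, hh⟩ := hg
  obtain ⟨k, hk⟩ := hφ
  exact ⟨_, hh.sub hk⟩

lemma roughness_affine (a b : ℝ) : roughness (fun t => a + b * t) = 0 := by
  simp [(hasSecondDeriv_affine a b).roughness_eq]

lemma roughness_const_mul (hg : MemH2 g) (c : ℝ) :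
    roughness (fun t => c * g t) = c ^ 2 * roughness g := by
  obtain ⟨h, hh⟩ := hg
  rw [(hh.const_mul c).roughness_eq, hh.roughness_eq, ← intervalIntegral.integral_const_mul]
  simp only [mul_pow]

lemma HasSecondDeriv.integral_add_sq (hg : HasSecondDeriv g h) (hφ : HasSecondDeriv φ k)
    (s : ℝ) :
    roughness (fun t => g t + s * φ t) =
      roughness g + 2 * s * (∫ t in (0 : ℝ)..1, h t * k t) + s ^ 2 * roughness φ := by
  rw [(hg.add (hφ.const_mul s)).roughness_eq, hg.roughness_eq, hφ.roughness_eq]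
  have h1 := memLp_mul_intervalIntegrable hg.1 hg.1 (a := 0) (b := 1) (by simp) (by simp)
  have h2 := memLp_mul_intervalIntegrable hg.1 hφ.1 (a := 0) (b := 1) (by simp) (by simp)
  have h3 := memLp_mul_intervalIntegrable hφ.1 hφ.1 (a := 0) (b := 1) (by simp) (by simp)
  calc ∫ t in (0 : ℝ)..1, (h t + s * k t) ^ 2
      = ∫ t in (0 : ℝ)..1, (h t * h t + 2 * s * (h t * k t) + s ^ 2 * (k t * k t)) := by
        congr 1; ext t; ring
    _ = _ := by
        rw [intervalIntegral.integral_add (h1.add (h2.const_mul _)) (h3.const_mul _),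
          intervalIntegral.integral_add h1 (h2.const_mul _),
          intervalIntegral.integral_const_mul, intervalIntegral.integral_const_mul]
        simp only [sq]

lemma roughness_sub_le (hg : MemH2 g) (hφ : MemH2 φ) :
    roughness (fun t => g t - φ t) ≤ 2 * roughness g + 2 * roughness φ := by
  obtain ⟨h, hh⟩ := hg
  obtain ⟨k, hk⟩ := hφ
  have h1 := hh.integral_add_sq hk (-1)
  have h2 := hh.integral_add_sq hk 1
  have h3 := roughness_nonneg (fun t => g t + 1 * φ t)
  have h4 : (fun t => g t + -1 * φ t) = fun t => g t - φ t := by ext t; ring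
  rw [h4] at h1
  linarith

/-- Cauchy-Schwarz: the integral of `h` over an interval is at most the square root of its length
times the square root of the energy. -/
lemma abs_integral_le_sqrt (hh : MemLp h 2 (volume.restrict (Icc (0 : ℝ) 1))) {a b : ℝ}
    (ha : a ∈ Icc (0 : ℝ) 1) (hb : b ∈ Icc (0 : ℝ) 1) :
    |∫ u in a..b, h u| ≤ √|b - a| * √(∫ t in (0 : ℝ)..1, h t ^ 2) := by
  wlog hab : a ≤ b generalizing a b
  · rw [intervalIntegral.integral_symm, abs_neg, abs_sub_comm]
    exact this hb ha (le_of_not_ge hab)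
  rcases hab.eq_or_lt with rfl | hlt
  · simp
  have hpos : 0 < b - a := sub_pos.2 hlt
  set A := ∫ u in a..b, h u with hA
  have h1 := memLp_intervalIntegrable hh ha hb
  have h2 := memLp_mul_intervalIntegrable hh hh ha hb
  have hle : ∫ u in a..b, h u * h u ≤ ∫ t in (0 : ℝ)..1, h t ^ 2 := by
    simp only [← sq]
    refine intervalIntegral.integral_mono_interval ha.1 hab hb.2
      (Eventually.of_forall fun _ => sq_nonneg _) ?_
    simpa only [sq] using memLp_mul_intervalIntegrable hh hh (a := 0) (b := 1) (by simp) (by simp)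
  set c := A / (b - a) with hc
  have hcA : c * (b - a) = A := div_mul_cancel₀ _ hpos.ne'
  have h3 : 0 ≤ ∫ u in a..b, (h u - c) ^ 2 :=
    intervalIntegral.integral_nonneg hab fun _ _ => sq_nonneg _
  have h4 : ∫ u in a..b, (h u - c) ^ 2 = (∫ u in a..b, h u * h u) - 2 * c * A
      + c ^ 2 * (b - a) := by
    calc ∫ u in a..b, (h u - c) ^ 2 = ∫ u in a..b, (h u * h u - 2 * c * h u + c ^ 2) := by
          congr 1; ext u; ring
      _ = _ := by
        rw [intervalIntegral.integral_add (h2.sub (h1.const_mul _)) (by simp),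
          intervalIntegral.integral_sub h2 (h1.const_mul _), intervalIntegral.integral_const_mul]
        rw [intervalIntegral.integral_const, ← hA, smul_eq_mul]
        ring
  have h5 : A ^ 2 ≤ (b - a) * ∫ t in (0 : ℝ)..1, h t ^ 2 := by
    have h6 : c * A ≤ ∫ t in (0 : ℝ)..1, h t ^ 2 := by
      have : c ^ 2 * (b - a) = c * A := by rw [sq, mul_assoc, hcA]
      nlinarith
    calc A ^ 2 = (b - a) * (c * A) := by rw [← hcA]; ring
      _ ≤ _ := by gcongr
  rw [abs_of_pos hpos, ← Real.sqrt_mul hpos.le]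
  exact Real.abs_le_sqrt h5

/-- First-order Taylor expansion with remainder `|b - a|^{3/2} R(g)^{1/2}`. -/
lemma exists_taylor (hg : MemH2 g) : ∃ g₁ : ℝ → ℝ, ∀ a ∈ Icc (0 : ℝ) 1, ∀ b ∈ Icc (0 : ℝ) 1,
    |g b - g a - g₁ a * (b - a)| ≤ |b - a| * √|b - a| * √(roughness g) := by
  obtain ⟨h, hh⟩ := hg
  rw [hh.roughness_eq]
  obtain ⟨hm, g₁, hg₁, hgi⟩ := hh
  refine ⟨g₁, fun a ha b hb => ?_⟩
  have hsub : uIcc a b ⊆ Icc (0 : ℝ) 1 := Set.uIcc_subset_Icc ha hb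
  have key := (convex_uIcc a b).norm_image_sub_le_of_norm_hasDerivWithin_le
    (f := fun s => g s - g₁ a * s) (f' := fun s => g₁ s - g₁ a)
    (C := √|b - a| * √(∫ t in (0 : ℝ)..1, h t ^ 2)) (x := a) (y := b)
    (fun s hs => by
      have h1 := (hg₁ s (hsub hs)).mono hsub
      have h2 := (hasDerivWithinAt_id s (uIcc a b)).const_mul (g₁ a)
      rw [mul_one] at h2
      exact h1.sub h2)
    (fun s hs => by
      have h1 : g₁ s - g₁ a = ∫ u in a..s, h u := by
        rw [← intervalIntegral.integral_interval_sub_left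
          (memLp_intervalIntegrable hm (a := 0) (by simp) (hsub hs))
          (memLp_intervalIntegrable hm (a := 0) (by simp) ha), ← hgi s (hsub hs), ← hgi a ha]
        ring
      rw [h1, Real.norm_eq_abs]
      refine (abs_integral_le_sqrt hm ha (hsub hs)).trans ?_
      have h2 := Real.sqrt_le_sqrt (Set.abs_sub_left_of_mem_uIcc hs)
      gcongr)
    (by simp) (by simp)
  simp only [Real.norm_eq_abs] at key
  calc |g b - g a - g₁ a * (b - a)| = |g b - g₁ a * b - (g a - g₁ a * a)| := by congr 1; ring
    _ ≤ _ := key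
    _ = _ := by ring

/-- Second differences with step `s` are at most `5 |s|^{3/2} R(g)^{1/2}`. -/
lemma abs_second_difference_le (hg : MemH2 g) {t s : ℝ} (ht : t ∈ Icc (0 : ℝ) 1)
    (hs : t + 2 * s ∈ Icc (0 : ℝ) 1) :
    |g (t + 2 * s) - 2 * g (t + s) + g t| ≤ 5 * (|s| * √|s|) * √(roughness g) := by
  obtain ⟨g₁, hT⟩ := exists_taylor hg
  have hs1 : t + s ∈ Icc (0 : ℝ) 1 := by
    constructor <;> linarith [ht.1, ht.2, hs.1, hs.2]
  have h1 := hT t ht _ hs1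
  have h2 := hT t ht _ hs
  rw [add_sub_cancel_left] at h1 h2
  have h3 : √|2 * s| ≤ 3 / 2 * √|s| := by
    rw [abs_mul, Real.sqrt_mul (by positivity)]
    gcongr
    rw [Real.sqrt_le_left (by norm_num)]
    norm_num
  have h4 : |2 * s| * √|2 * s| * √(roughness g) ≤ 3 * (|s| * √|s|) * √(roughness g) := by
    calc _ ≤ |2 * s| * (3 / 2 * √|s|) * √(roughness g) := by gcongr
      _ = _ := by rw [abs_mul, abs_two]; ring
  calc |g (t + 2 * s) - 2 * g (t + s) + g t|
      = |(g (t + 2 * s) - g t - g₁ t * (2 * s)) - 2 * (g (t + s) - g t - g₁ t * s)| := by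
        congr 1; ring
    _ ≤ |g (t + 2 * s) - g t - g₁ t * (2 * s)| + 2 * |g (t + s) - g t - g₁ t * s| := by
        refine (abs_sub _ _).trans ?_
        rw [abs_mul, abs_two]
    _ ≤ 3 * (|s| * √|s|) * √(roughness g) + 2 * (|s| * √|s| * √(roughness g)) :=
        add_le_add (h2.trans h4) (by gcongr)
    _ = _ := by ring

end SecondDeriv

/-! ### Existence of smoothing splines -/

section Existence

/-- Lebesgue measure on the unit interval. -/
abbrev unitMeasure : Measure ℝ := volume.restrict (Icc (0 : ℝ) 1)

/-- The twice iterated primitive of `h`. Integrating against the restricted measure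
makes it depend only on the class of `h` in `L²(0, 1)`. -/
def doubleInt (h : ℝ → ℝ) (t : ℝ) : ℝ := ∫ s in (0 : ℝ)..t, ∫ u in (0 : ℝ)..s, h u ∂unitMeasure

variable {g h k : ℝ → ℝ}

lemma integral_unitMeasure {s : ℝ} (hs : s ∈ Icc (0 : ℝ) 1) :
    ∫ u in (0 : ℝ)..s, h u ∂unitMeasure = ∫ u in (0 : ℝ)..s, h u := by
  rw [intervalIntegral.integral_of_le hs.1, intervalIntegral.integral_of_le hs.1,
    Measure.restrict_restrict measurableSet_Ioc,
    show Ioc 0 s ∩ Icc 0 1 = Ioc 0 s from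
      inter_eq_left.2 fun x hx => ⟨hx.1.le, hx.2.trans hs.2⟩]

lemma memLp_intervalIntegrable_unitMeasure (hh : MemLp h 2 unitMeasure) (a b : ℝ) :
    IntervalIntegrable h unitMeasure a b :=
  (hh.integrable (by norm_num)).intervalIntegrable

lemma continuous_primitive_unitMeasure (hh : MemLp h 2 unitMeasure) :
    Continuous fun s => ∫ u in (0 : ℝ)..s, h u ∂unitMeasure :=
  intervalIntegral.continuous_primitive (memLp_intervalIntegrable_unitMeasure hh) 0

lemma hasSecondDeriv_doubleInt (hh : MemLp h 2 unitMeasure) :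
    HasSecondDeriv (doubleInt h) h := by
  refine ⟨hh, fun s => ∫ u in (0 : ℝ)..s, h u ∂unitMeasure, fun t _ => ?_, fun t ht => ?_⟩
  · exact ((continuous_primitive_unitMeasure hh).integral_hasStrictDerivAt 0 t).hasDerivAt
      |>.hasDerivWithinAt
  · simp [integral_unitMeasure ht]

lemma doubleInt_congr (hhk : h =ᵐ[unitMeasure] k) (t : ℝ) : doubleInt h t = doubleInt k t := by
  unfold doubleInt
  congr 1
  ext s
  exact intervalIntegral.integral_congr_ae (hhk.mono fun _ hx _ => hx)

lemma doubleInt_add (hh : MemLp h 2 unitMeasure) (hk : MemLp k 2 unitMeasure) (t : ℝ) :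
    doubleInt (h + k) t = doubleInt h t + doubleInt k t := by
  unfold doubleInt
  rw [← intervalIntegral.integral_add
    ((continuous_primitive_unitMeasure hh).intervalIntegrable _ _)
    ((continuous_primitive_unitMeasure hk).intervalIntegrable _ _)]
  congr 1
  ext s
  exact intervalIntegral.integral_add (memLp_intervalIntegrable_unitMeasure hh 0 s)
    (memLp_intervalIntegrable_unitMeasure hk 0 s)

lemma doubleInt_smul (c : ℝ) (h : ℝ → ℝ) (t : ℝ) :
    doubleInt (c • h) t = c * doubleInt h t := by
  simp [doubleInt, intervalIntegral.integral_const_mul]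

lemma integral_sq_unitMeasure (h : ℝ → ℝ) :
    ∫ t in (0 : ℝ)..1, h t ^ 2 = ∫ t, h t ^ 2 ∂unitMeasure := by
  rw [intervalIntegral.integral_of_le zero_le_one, integral_Icc_eq_integral_Ioc]

lemma norm_sq_Lp (F : Lp ℝ 2 unitMeasure) : ‖F‖ ^ 2 = ∫ t in (0 : ℝ)..1, F t ^ 2 := by
  rw [integral_sq_unitMeasure, ← real_inner_self_eq_norm_sq, L2.inner_def]
  simp [sq]

lemma abs_doubleInt_le (F : Lp ℝ 2 unitMeasure) {t : ℝ} (ht : t ∈ Icc (0 : ℝ) 1) :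
    |doubleInt F t| ≤ ‖F‖ := by
  have h1 : ∀ s ∈ uIoc 0 t, ‖∫ u in (0 : ℝ)..s, F u ∂unitMeasure‖ ≤ ‖F‖ := by
    intro s hs
    rw [uIoc_of_le ht.1] at hs
    have hs' : s ∈ Icc (0 : ℝ) 1 := ⟨hs.1.le, hs.2.trans ht.2⟩
    rw [integral_unitMeasure hs']
    refine (abs_integral_le_sqrt (Lp.memLp F) (by simp) hs').trans ?_
    rw [← norm_sq_Lp, Real.sqrt_sq (norm_nonneg _)]
    refine mul_le_of_le_one_left (norm_nonneg _) (Real.sqrt_le_one.2 ?_)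
    rw [sub_zero, abs_of_nonneg hs'.1]
    exact hs'.2
  refine (intervalIntegral.norm_integral_le_of_norm_le_const h1).trans ?_
  rw [sub_zero, abs_of_nonneg ht.1]
  exact mul_le_of_le_one_right (norm_nonneg _) ht.2

/-- Evaluation of the twice iterated primitive, as a continuous functional on `L²(0, 1)`. -/
def doubleIntL (t : ℝ) (ht : t ∈ Icc (0 : ℝ) 1) : Lp ℝ 2 unitMeasure →L[ℝ] ℝ :=
  LinearMap.mkContinuous
    { toFun := fun F => doubleInt F t
      map_add' := fun F G => by
        rw [doubleInt_congr (Lp.coeFn_add F G), doubleInt_add (Lp.memLp F) (Lp.memLp G)]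
      map_smul' := fun c F => by
        rw [doubleInt_congr (Lp.coeFn_smul c F), doubleInt_smul]; rfl }
    1 fun F => by simpa using abs_doubleInt_le F ht

/-- A function with second derivative `h` differs from the twice iterated primitive of `h` by an
affine function. -/
lemma HasSecondDeriv.eq_affine_add (hg : HasSecondDeriv g h) :
    ∃ a b : ℝ, ∀ t ∈ Icc (0 : ℝ) 1, g t = a + b * t + doubleInt h t := by
  have h1 := hg.sub (hasSecondDeriv_doubleInt hg.1)
  have h2 : roughness (fun t => g t - doubleInt h t) = 0 := by simp [h1.roughness_eq]
  obtain ⟨g₁, hg₁⟩ := exists_taylor ⟨_, h1⟩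
  refine ⟨g 0 - doubleInt h 0, g₁ 0, fun t ht => ?_⟩
  have h3 := hg₁ 0 (by simp) t ht
  rw [h2, Real.sqrt_zero, mul_zero] at h3
  have h4 := abs_nonpos_iff.1 h3
  linarith

lemma design_mem {n i : ℕ} (hi : i ∈ Finset.Icc 1 n) : design n i ∈ Icc (0 : ℝ) 1 := by
  rw [Finset.mem_Icc] at hi
  refine ⟨by unfold design; positivity, ?_⟩
  unfold design
  exact div_le_one_of_le₀ (by exact_mod_cast hi.2) (by positivity)

/-- The weighted spline problem has a solution, as the orthogonal projection of the data onto a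
closed subspace of `ℝⁿ × L²(0, 1)`. -/
lemma exists_isWeightedSpline (n : ℕ) {lam : ℕ → ℝ} (hlam : ∀ i, 0 ≤ lam i) (y : ℕ → ℝ) :
    ∃ g, IsWeightedSpline n lam y g := by
  let ι := Finset.Icc 1 n
  let W := EuclideanSpace ℝ ι
  let E := WithLp 2 (W × Lp ℝ 2 unitMeasure)
  let Λ : Lp ℝ 2 unitMeasure →L[ℝ] W :=
    (EuclideanSpace.equiv ι ℝ).symm.toContinuousLinearMap ∘L
      ContinuousLinearMap.pi fun i : ι => √(lam i) • doubleIntL (design n i) (design_mem i.2)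
  let T : ℝ × ℝ →ₗ[ℝ] W :=
    { toFun := fun p => WithLp.toLp 2 fun i : ι => √(lam i) * (p.1 + p.2 * design n i)
      map_add' := fun p p' => by
        ext i
        change √(lam i) * (p.1 + p'.1 + (p.2 + p'.2) * design n i) =
          √(lam i) * (p.1 + p.2 * design n i) + √(lam i) * (p'.1 + p'.2 * design n i)
        ring
      map_smul' := fun c p => by
        ext i
        change √(lam i) * (c * p.1 + c * p.2 * design n i) =
          c * (√(lam i) * (p.1 + p.2 * design n i))
        ring }
  let D : E →L[ℝ] W := WithLp.fstL 2 ℝ W (Lp ℝ 2 unitMeasure) -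
    Λ ∘L WithLp.sndL 2 ℝ W (Lp ℝ 2 unitMeasure)
  let U : Submodule ℝ E := (LinearMap.range T).comap D.toLinearMap
  have hU : IsClosed (U : Set E) :=
    (Submodule.closed_of_finiteDimensional (LinearMap.range T)).preimage D.continuous
  let w : E := WithLp.toLp 2 (WithLp.toLp 2 fun i : ι => √(lam i) * y i, 0)
  obtain ⟨v, hvU, hv⟩ := U.exists_norm_eq_iInf_of_complete_subspace hU.isComplete w
  have hmin : ∀ u ∈ U, ‖w - v‖ ≤ ‖w - u‖ := fun u hu => by
    rw [hv]
    exact ciInf_le ⟨0, forall_mem_range.2 fun _ => norm_nonneg _⟩ (⟨u, hu⟩ : (U : Set E))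
  have hobj : ∀ (u : E) (g : ℝ → ℝ), HasSecondDeriv g u.snd →
      (∀ i : ι, u.fst i = √(lam i) * g (design n i)) →
      ‖w - u‖ ^ 2 = splineObjective n lam y g := by
    intro u g hg hu
    rw [WithLp.prod_norm_sq_eq_of_L2, EuclideanSpace.real_norm_sq_eq, splineObjective,
      hg.roughness_eq, ← norm_sq_Lp, ← Finset.sum_coe_sort (Finset.Icc 1 n)]
    have h2 : (w - u).snd = -u.snd := zero_sub u.snd
    rw [h2, norm_neg]
    congr 1
    refine Finset.sum_congr rfl fun i _ => ?_
    have h3 : (w - u).fst i = √(lam i) * (y i - g (design n i)) := by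
      rw [mul_sub, ← hu i]
      rfl
    rw [h3, mul_pow, Real.sq_sqrt (hlam i)]
  obtain ⟨p, hp⟩ := hvU
  let g : ℝ → ℝ := fun t => p.1 + p.2 * t + doubleInt v.snd t
  have hg : HasSecondDeriv g v.snd := by
    have := (hasSecondDeriv_affine p.1 p.2).add (hasSecondDeriv_doubleInt (Lp.memLp v.snd))
    simpa using this
  have hgv : ∀ i : ι, v.fst i = √(lam i) * g (design n i) := by
    intro i
    have h1 : √(lam i) * (p.1 + p.2 * design n i) =
        v.fst i - √(lam i) * doubleInt v.snd (design n i) := congrArg (fun x : W => x i) hp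
    simp only [g]
    linarith
  refine ⟨g, ⟨_, hg⟩, ?_⟩
  rintro φ ⟨k, hk⟩
  obtain ⟨a, b, hab⟩ := hk.eq_affine_add
  let F : Lp ℝ 2 unitMeasure := hk.1.toLp k
  have hF : F =ᵐ[unitMeasure] k := hk.1.coeFn_toLp
  let u : E := WithLp.toLp 2 (WithLp.toLp 2 fun i : ι => √(lam i) * φ (design n i), F)
  have huU : u ∈ U := by
    refine ⟨(a, b), ?_⟩
    ext i
    change √(lam i) * (a + b * design n i) =
      √(lam i) * φ (design n i) - √(lam i) * doubleInt F (design n i)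
    rw [doubleInt_congr hF, hab _ (design_mem i.2)]
    ring
  have hφ : HasSecondDeriv φ F := by
    refine ⟨Lp.memLp F, ?_⟩
    obtain ⟨φ₁, hφ₁, hφi⟩ := hk.2
    refine ⟨φ₁, hφ₁, fun t ht => ?_⟩
    rw [hφi t ht, ← integral_unitMeasure ht, ← integral_unitMeasure ht]
    exact intervalIntegral.integral_congr_ae (hF.mono fun _ hx _ => hx.symm)
  rw [← hobj v g hg hgv, ← hobj u φ hφ fun i => rfl]
  exact pow_le_pow_left₀ (norm_nonneg _) (hmin u huU) 2

lemma isWeightedSpline_weightedSpline (n : ℕ) {lam : ℕ → ℝ} (hlam : ∀ i, 0 ≤ lam i)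
    (y : ℕ → ℝ) : IsWeightedSpline n lam y (weightedSpline n lam y) :=
  Classical.epsilon_spec (exists_isWeightedSpline n hlam y)

end Existence

/-! ### Normal equations -/

section Normal

variable {n : ℕ} {lam y : ℕ → ℝ} {g φ h k : ℝ → ℝ}

/-- A quadratic without constant term that is nonnegative everywhere has no linear term. -/
lemma eq_zero_of_forall_nonneg {a b : ℝ} (H : ∀ s : ℝ, 0 ≤ a * s + b * s ^ 2) : a = 0 := by
  have h1 := discrim_le_zero (a := b) (b := a) (c := 0) fun s => by
    have := H s
    linarith [sq s]
  rw [discrim, mul_zero, sub_zero] at h1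
  exact pow_eq_zero_iff two_ne_zero |>.1 (le_antisymm h1 (sq_nonneg a))

lemma splineObjective_add_mul (hg : HasSecondDeriv g h) (hφ : HasSecondDeriv φ k) (s : ℝ) :
    splineObjective n lam y (fun t => g t + s * φ t) = splineObjective n lam y g
      + 2 * ((∫ t in (0 : ℝ)..1, h t * k t) -
          ∑ i ∈ Finset.Icc 1 n, lam i * (y i - g (design n i)) * φ (design n i)) * s
      + (∑ i ∈ Finset.Icc 1 n, lam i * φ (design n i) ^ 2 + roughness φ) * s ^ 2 := by
  unfold splineObjective
  rw [hg.integral_add_sq hφ]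
  have h1 : ∑ i ∈ Finset.Icc 1 n, lam i * (y i - (g (design n i) + s * φ (design n i))) ^ 2 =
      ∑ i ∈ Finset.Icc 1 n, lam i * (y i - g (design n i)) ^ 2
      - 2 * s * ∑ i ∈ Finset.Icc 1 n, lam i * (y i - g (design n i)) * φ (design n i)
      + s ^ 2 * ∑ i ∈ Finset.Icc 1 n, lam i * φ (design n i) ^ 2 := by
    rw [Finset.mul_sum, Finset.mul_sum, ← Finset.sum_sub_distrib, ← Finset.sum_add_distrib]
    exact Finset.sum_congr rfl fun i _ => by ring
  rw [h1]
  ring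

lemma IsWeightedSpline.normal_eq (hs : IsWeightedSpline n lam y g) (hg : HasSecondDeriv g h)
    (hφ : HasSecondDeriv φ k) :
    ∑ i ∈ Finset.Icc 1 n, lam i * (y i - g (design n i)) * φ (design n i) =
      ∫ t in (0 : ℝ)..1, h t * k t := by
  have h1 := eq_zero_of_forall_nonneg fun s => by
    have h2 := hs.2 _ ⟨_, hg.add (hφ.const_mul s)⟩
    rw [splineObjective_add_mul hg hφ s, add_assoc] at h2
    exact le_add_iff_nonneg_right _ |>.1 h2
  linarith

/-- The normal equations characterize smoothing splines, by convexity. -/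
lemma isWeightedSpline_of_normal_eq (hlam : ∀ i, 0 ≤ lam i) (hg : HasSecondDeriv g h)
    (H : ∀ φ k, HasSecondDeriv φ k →
      ∑ i ∈ Finset.Icc 1 n, lam i * (y i - g (design n i)) * φ (design n i) =
        ∫ t in (0 : ℝ)..1, h t * k t) : IsWeightedSpline n lam y g := by
  refine ⟨⟨_, hg⟩, ?_⟩
  rintro ψ ⟨k, hk⟩
  have h1 := splineObjective_add_mul (n := n) (lam := lam) (y := y) hg (hk.sub hg) 1
  rw [H _ _ (hk.sub hg), sub_self] at h1
  have h2 : (fun t => g t + 1 * (ψ t - g t)) = ψ := by ext t; ring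
  rw [h2] at h1
  rw [h1]
  have h3 : 0 ≤ ∑ i ∈ Finset.Icc 1 n, lam i * (ψ (design n i) - g (design n i)) ^ 2 :=
    Finset.sum_nonneg fun i _ => mul_nonneg (hlam i) (sq_nonneg _)
  have h4 := roughness_nonneg fun t => ψ t - g t
  linarith

lemma exists_isLeastSquares (n : ℕ) (y : ℕ → ℝ) : ∃ p, IsLeastSquares n y p := by
  let ι := Finset.Icc 1 n
  let W := EuclideanSpace ℝ ι
  let T : ℝ × ℝ →ₗ[ℝ] W :=
    { toFun := fun p => WithLp.toLp 2 fun i : ι => p.1 + p.2 * design n i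
      map_add' := fun p p' => by
        ext i
        change p.1 + p'.1 + (p.2 + p'.2) * design n i =
          p.1 + p.2 * design n i + (p'.1 + p'.2 * design n i)
        ring
      map_smul' := fun c p => by
        ext i
        change c * p.1 + c * p.2 * design n i = c * (p.1 + p.2 * design n i)
        ring }
  let w : W := WithLp.toLp 2 fun i : ι => y i
  obtain ⟨v, ⟨p, hp⟩, hv⟩ := (LinearMap.range T).exists_norm_eq_iInf_of_complete_subspace
    (Submodule.closed_of_finiteDimensional (LinearMap.range T)).isComplete w
  have hobj : ∀ p : ℝ × ℝ, ‖w - T p‖ ^ 2 =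
      ∑ i ∈ Finset.Icc 1 n, (y i - (p.1 + p.2 * design n i)) ^ 2 := fun p => by
    rw [EuclideanSpace.real_norm_sq_eq, ← Finset.sum_coe_sort (Finset.Icc 1 n)]
    rfl
  refine ⟨p, fun p' => ?_⟩
  rw [← hobj, ← hobj, hp, hv]
  refine pow_le_pow_left₀ (Real.iInf_nonneg fun _ => norm_nonneg _) ?_ 2
  exact ciInf_le ⟨0, forall_mem_range.2 fun _ => norm_nonneg _⟩
    (⟨T p', ⟨p', rfl⟩⟩ : (LinearMap.range T : Set W))

lemma memH2_lsLine (n : ℕ) (y : ℕ → ℝ) : MemH2 (lsLine n y) :=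
  ⟨_, hasSecondDeriv_affine _ _⟩

lemma roughness_lsLine (n : ℕ) (y : ℕ → ℝ) : roughness (lsLine n y) = 0 :=
  roughness_affine _ _

/-- The residuals of the least squares line are orthogonal to the affine functions. -/
lemma lsLine_normal_eq (n : ℕ) (y : ℕ → ℝ) (a b : ℝ) :
    ∑ i ∈ Finset.Icc 1 n, (y i - lsLine n y (design n i)) * (a + b * design n i) = 0 := by
  have hp : IsLeastSquares n y _ := Classical.epsilon_spec (exists_isLeastSquares n y)
  set p := Classical.epsilon (IsLeastSquares n y) with hpdef
  have hl : ∀ t, lsLine n y t = p.1 + p.2 * t := fun t => rfl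
  simp only [hl]
  have h1 := eq_zero_of_forall_nonneg
    (a := -2 * ∑ i ∈ Finset.Icc 1 n, (y i - (p.1 + p.2 * design n i)) * (a + b * design n i))
    (b := ∑ i ∈ Finset.Icc 1 n, (a + b * design n i) ^ 2) fun s => by
    have h2 := hp (p.1 + s * a, p.2 + s * b)
    have h3 : ∑ i ∈ Finset.Icc 1 n, (y i - (p.1 + s * a + (p.2 + s * b) * design n i)) ^ 2 =
        ∑ i ∈ Finset.Icc 1 n, (y i - (p.1 + p.2 * design n i)) ^ 2 +
        (-2 * s * (∑ i ∈ Finset.Icc 1 n,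
            (y i - (p.1 + p.2 * design n i)) * (a + b * design n i)) +
          s ^ 2 * ∑ i ∈ Finset.Icc 1 n, (a + b * design n i) ^ 2) := by
      rw [Finset.mul_sum, Finset.mul_sum, ← Finset.sum_add_distrib, ← Finset.sum_add_distrib]
      exact Finset.sum_congr rfl fun i _ => by ring
    simp only at h2
    rw [h3] at h2
    linarith
  linarith

end Normal

/-! ### Splines with equal weights -/

section EqualWeights

variable {n : ℕ} {lam lam' : ℝ} {y y' : ℕ → ℝ} {g g' φ h k : ℝ → ℝ}

/-- `g` solves the spline problem with all weights equal to `lam`. -/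
abbrev IsEqualSpline (n : ℕ) (lam : ℝ) (y : ℕ → ℝ) (g : ℝ → ℝ) : Prop :=
  IsWeightedSpline n (fun _ => lam) y g

lemma IsEqualSpline.normal_eq (hs : IsEqualSpline n lam y g) (hg : HasSecondDeriv g h)
    (hφ : HasSecondDeriv φ k) :
    lam * ∑ i ∈ Finset.Icc 1 n, (y i - g (design n i)) * φ (design n i) =
      ∫ t in (0 : ℝ)..1, h t * k t := by
  rw [← IsWeightedSpline.normal_eq hs hg hφ, Finset.mul_sum]
  exact Finset.sum_congr rfl fun i _ => by ring

lemma isEqualSpline_of_normal_eq (hlam : 0 ≤ lam) (hg : HasSecondDeriv g h)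
    (H : ∀ φ k, HasSecondDeriv φ k →
      lam * ∑ i ∈ Finset.Icc 1 n, (y i - g (design n i)) * φ (design n i) =
        ∫ t in (0 : ℝ)..1, h t * k t) : IsEqualSpline n lam y g := by
  refine isWeightedSpline_of_normal_eq (fun _ => hlam) hg fun φ k hφ => ?_
  rw [← H φ k hφ, Finset.mul_sum]
  exact Finset.sum_congr rfl fun i _ => by ring

lemma splineObjective_equal (n : ℕ) (lam : ℝ) (y : ℕ → ℝ) (g : ℝ → ℝ) :
    splineObjective n (fun _ => lam) y g =
      lam * ∑ i ∈ Finset.Icc 1 n, (y i - g (design n i)) ^ 2 + roughness g := by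
  rw [splineObjective, Finset.mul_sum]

lemma IsEqualSpline.le (hs : IsEqualSpline n lam y g) (hφ : MemH2 φ) :
    lam * ∑ i ∈ Finset.Icc 1 n, (y i - g (design n i)) ^ 2 + roughness g ≤
      lam * ∑ i ∈ Finset.Icc 1 n, (y i - φ (design n i)) ^ 2 + roughness φ := by
  simpa only [splineObjective_equal] using hs.2 φ hφ

/-- Comparison with the function zero: the map from the data to the residuals is a contraction. -/
lemma IsEqualSpline.sum_sq_resid_le (hs : IsEqualSpline n lam y g) (hlam : 0 < lam) :
    ∑ i ∈ Finset.Icc 1 n, (y i - g (design n i)) ^ 2 ≤ ∑ i ∈ Finset.Icc 1 n, y i ^ 2 := by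
  have h1 := hs.le (φ := fun t => 0 + 0 * t) ⟨_, hasSecondDeriv_affine 0 0⟩
  rw [roughness_affine] at h1
  simp only [zero_mul, add_zero, sub_zero] at h1
  have h2 := roughness_nonneg g
  exact le_of_mul_le_mul_left (by linarith) hlam

/-- Difference of the normal equations of two splines for the same data. -/
lemma IsEqualSpline.sub_normal_eq (hs : IsEqualSpline n lam y g)
    (hs' : IsEqualSpline n lam' y g') :
    0 ≤ lam * ∑ i ∈ Finset.Icc 1 n, (y i - g (design n i)) * (g (design n i) - g' (design n i))
      - lam' * ∑ i ∈ Finset.Icc 1 n,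
        (y i - g' (design n i)) * (g (design n i) - g' (design n i)) := by
  obtain ⟨h, hg⟩ := hs.1
  obtain ⟨h', hg'⟩ := hs'.1
  have hd := hg.sub hg'
  rw [hs.normal_eq hg hd, hs'.normal_eq hg' hd, ← intervalIntegral.integral_sub
    (memLp_mul_intervalIntegrable hg.1 hd.1 (by simp) (by simp))
    (memLp_mul_intervalIntegrable hg'.1 hd.1 (by simp) (by simp))]
  refine intervalIntegral.integral_nonneg zero_le_one fun t _ => ?_
  rw [← sub_mul]
  exact mul_self_nonneg _

/-- The distance between the fitted values at two weights is of the order of the difference of the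
weights, as long as `lam'` is bounded away from zero. -/
lemma IsEqualSpline.sum_sq_sub_le (hs : IsEqualSpline n lam y g)
    (hs' : IsEqualSpline n lam' y g') :
    lam' * ∑ i ∈ Finset.Icc 1 n, (g (design n i) - g' (design n i)) ^ 2 ≤
      (lam - lam') * ∑ i ∈ Finset.Icc 1 n,
        (y i - g (design n i)) * (g (design n i) - g' (design n i)) := by
  have h1 := hs.sub_normal_eq hs'
  have h2 : ∑ i ∈ Finset.Icc 1 n, (y i - g' (design n i)) * (g (design n i) - g' (design n i)) =
      ∑ i ∈ Finset.Icc 1 n, (y i - g (design n i)) * (g (design n i) - g' (design n i)) +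
      ∑ i ∈ Finset.Icc 1 n, (g (design n i) - g' (design n i)) ^ 2 := by
    rw [← Finset.sum_add_distrib]
    exact Finset.sum_congr rfl fun i _ => by ring
  rw [h2] at h1
  linarith

lemma IsEqualSpline.eq_design (hs : IsEqualSpline n lam y g) (hs' : IsEqualSpline n lam y g')
    (hlam : 0 < lam) {i : ℕ} (hi : i ∈ Finset.Icc 1 n) : g (design n i) = g' (design n i) := by
  have h1 := hs.sum_sq_sub_le hs'
  rw [sub_self, zero_mul] at h1
  have h2 : ∑ i ∈ Finset.Icc 1 n, (g (design n i) - g' (design n i)) ^ 2 ≤ 0 :=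
    nonpos_of_mul_nonpos_right h1 hlam
  have h3 := (Finset.single_le_sum (f := fun i => (g (design n i) - g' (design n i)) ^ 2)
    (fun _ _ => sq_nonneg _) hi).trans h2
  exact sub_eq_zero.1 (pow_eq_zero_iff two_ne_zero |>.1 (le_antisymm h3 (sq_nonneg _)))

lemma IsEqualSpline.roughness_eq (hs : IsEqualSpline n lam y g) (hs' : IsEqualSpline n lam y g')
    (hlam : 0 < lam) : roughness g = roughness g' := by
  have h1 := hs.le hs'.1
  have h2 := hs'.le hs.1
  have h3 : ∑ i ∈ Finset.Icc 1 n, (y i - g (design n i)) ^ 2 =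
      ∑ i ∈ Finset.Icc 1 n, (y i - g' (design n i)) ^ 2 :=
    Finset.sum_congr rfl fun i hi => by rw [hs.eq_design hs' hlam hi]
  rw [h3] at h1 h2
  linarith

/-- The roughness of the spline increases with the weight. -/
lemma IsEqualSpline.roughness_mono (hs : IsEqualSpline n lam y g)
    (hs' : IsEqualSpline n lam' y g') (hlam : 0 < lam) (hle : lam ≤ lam') :
    roughness g ≤ roughness g' := by
  rcases hle.eq_or_lt with rfl | hlt
  · exact (hs.roughness_eq hs' hlam).le
  have h1 := hs.le hs'.1
  have h2 := hs'.le hs.1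
  set Q := ∑ i ∈ Finset.Icc 1 n, (y i - g (design n i)) ^ 2
  set Q' := ∑ i ∈ Finset.Icc 1 n, (y i - g' (design n i)) ^ 2
  have h3 : Q' ≤ Q := by
    have : (lam' - lam) * Q' ≤ (lam' - lam) * Q := by linarith
    exact le_of_mul_le_mul_left this (sub_pos.2 hlt)
  nlinarith

lemma IsEqualSpline.add_mul (hs : IsEqualSpline n lam y g) (hs' : IsEqualSpline n lam y' g')
    (hlam : 0 ≤ lam) (c : ℝ) :
    IsEqualSpline n lam (fun i => y i + c * y' i) (fun t => g t + c * g' t) := by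
  obtain ⟨h, hg⟩ := hs.1
  obtain ⟨h', hg'⟩ := hs'.1
  refine isEqualSpline_of_normal_eq hlam (hg.add (hg'.const_mul c)) fun φ k hφ => ?_
  have h1 : ∑ i ∈ Finset.Icc 1 n,
      (y i + c * y' i - (g (design n i) + c * g' (design n i))) * φ (design n i) =
      ∑ i ∈ Finset.Icc 1 n, (y i - g (design n i)) * φ (design n i) +
      c * ∑ i ∈ Finset.Icc 1 n, (y' i - g' (design n i)) * φ (design n i) := by
    rw [Finset.mul_sum, ← Finset.sum_add_distrib]
    exact Finset.sum_congr rfl fun i _ => by ring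
  rw [h1, mul_add, mul_left_comm lam c, hs.normal_eq hg hφ, hs'.normal_eq hg' hφ,
    ← intervalIntegral.integral_const_mul, ← intervalIntegral.integral_add
    (memLp_mul_intervalIntegrable hg.1 hφ.1 (by simp) (by simp))
    ((memLp_mul_intervalIntegrable hg'.1 hφ.1 (by simp) (by simp)).const_mul _)]
  congr 1
  ext t
  ring

lemma IsEqualSpline.congr (hs : IsEqualSpline n lam y g)
    (hy : ∀ i ∈ Finset.Icc 1 n, y i = y' i) : IsEqualSpline n lam y' g := by
  have h1 : ∀ φ, splineObjective n (fun _ => lam) y' φ = splineObjective n (fun _ => lam) y φ :=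
    fun φ => by
      unfold splineObjective
      congr 1
      exact Finset.sum_congr rfl fun i hi => by rw [hy i hi]
  exact ⟨hs.1, fun φ hφ => by simpa only [h1] using hs.2 φ hφ⟩

/-- The equal-weight spline for the data that are one at index `j` and zero elsewhere. Its value at
the `i`-th design point is the entry `(i, j)` of the smoother matrix. -/
def basisSpline (n : ℕ) (lam : ℝ) (j : ℕ) : ℝ → ℝ :=
  weightedSpline n (fun _ => lam) (Pi.single j 1)

lemma isEqualSpline_basisSpline (n : ℕ) (hlam : 0 ≤ lam) (j : ℕ) :
    IsEqualSpline n lam (Pi.single j 1) (basisSpline n lam j) :=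
  isWeightedSpline_weightedSpline n (fun _ => hlam) _

lemma isEqualSpline_zero (hlam : 0 ≤ lam) : IsEqualSpline n lam (fun _ => 0) (fun _ => 0) := by
  have h0 : HasSecondDeriv (fun _ => (0 : ℝ)) (fun _ => 0) := by
    simpa using hasSecondDeriv_affine 0 0
  exact isEqualSpline_of_normal_eq hlam h0 fun φ k _ => by simp

lemma isEqualSpline_sum (hlam : 0 ≤ lam) (s : Finset ℕ) (c : ℕ → ℝ) :
    IsEqualSpline n lam (fun i => ∑ j ∈ s, c j * (Pi.single j 1 : ℕ → ℝ) i)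
      (fun t => ∑ j ∈ s, c j * basisSpline n lam j t) := by
  induction s using Finset.induction_on with
  | empty => simpa using isEqualSpline_zero hlam
  | insert a s ha ih =>
    have h1 := ih.add_mul (isEqualSpline_basisSpline n hlam a) hlam (c a)
    simp only [Finset.sum_insert ha]
    simpa only [add_comm] using h1

/-- The spline is linear in the data. -/
lemma isEqualSpline_sum_basisSpline (hlam : 0 ≤ lam) (c : ℕ → ℝ) :
    IsEqualSpline n lam c (fun t => ∑ j ∈ Finset.Icc 1 n, c j * basisSpline n lam j t) := by
  refine (isEqualSpline_sum hlam (Finset.Icc 1 n) c).congr fun i hi => ?_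
  rw [Finset.sum_eq_single i]
  · simp
  · intro j _ hj
    simp [hj.symm]
  · exact fun h => absurd hi h

lemma sum_single_mul {j : ℕ} (hj : j ∈ Finset.Icc 1 n) (a b : ℕ → ℝ) :
    ∑ i ∈ Finset.Icc 1 n, ((Pi.single j 1 : ℕ → ℝ) i - a i) * b i =
      b j - ∑ i ∈ Finset.Icc 1 n, a i * b i := by
  simp only [sub_mul, Finset.sum_sub_distrib]
  congr 1
  rw [Finset.sum_eq_single j]
  · simp
  · intro i _ hi
    simp [hi]
  · exact fun h => absurd hj h

/-- The smoother matrix is symmetric. -/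
lemma basisSpline_symm (hlam : 0 < lam) {i j : ℕ} (hi : i ∈ Finset.Icc 1 n)
    (hj : j ∈ Finset.Icc 1 n) :
    basisSpline n lam i (design n j) = basisSpline n lam j (design n i) := by
  have hsi := isEqualSpline_basisSpline n hlam.le i
  have hsj := isEqualSpline_basisSpline n hlam.le j
  obtain ⟨h, hh⟩ := hsi.1
  obtain ⟨k, hk⟩ := hsj.1
  have h1 := hsi.normal_eq hh hk
  have h2 := hsj.normal_eq hk hh
  rw [sum_single_mul hi (fun l => basisSpline n lam i (design n l))
    (fun l => basisSpline n lam j (design n l))] at h1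
  rw [sum_single_mul hj (fun l => basisSpline n lam j (design n l))
    (fun l => basisSpline n lam i (design n l))] at h2
  have h3 : ∫ t in (0 : ℝ)..1, h t * k t = ∫ t in (0 : ℝ)..1, k t * h t := by
    congr 1
    ext t
    ring
  have h4 : ∑ l ∈ Finset.Icc 1 n,
        basisSpline n lam i (design n l) * basisSpline n lam j (design n l) =
      ∑ l ∈ Finset.Icc 1 n,
        basisSpline n lam j (design n l) * basisSpline n lam i (design n l) :=
    Finset.sum_congr rfl fun l _ => mul_comm _ _
  rw [h3, ← h2] at h1
  have h5 := mul_left_cancel₀ hlam.ne' h1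
  linarith

lemma IsEqualSpline.roughness_eq_sum (hs : IsEqualSpline n lam y g) :
    roughness g =
      lam * ∑ i ∈ Finset.Icc 1 n, (y i - g (design n i)) * g (design n i) := by
  obtain ⟨h, hg⟩ := hs.1
  rw [hs.normal_eq hg hg, hg.roughness_eq]
  simp only [sq]

lemma roughness_basisSpline (hlam : 0 ≤ lam) {j : ℕ} (hj : j ∈ Finset.Icc 1 n) :
    roughness (basisSpline n lam j) = lam * (basisSpline n lam j (design n j) -
      ∑ i ∈ Finset.Icc 1 n, basisSpline n lam j (design n i) ^ 2) := by
  rw [(isEqualSpline_basisSpline n hlam j).roughness_eq_sum,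
    sum_single_mul hj (fun l => basisSpline n lam j (design n l))
      (fun l => basisSpline n lam j (design n l))]
  simp only [sq]

lemma sum_indicator_mul {I : Finset ℕ} (hI : I ⊆ Finset.Icc 1 n) (w : ℕ → ℝ) :
    ∑ j ∈ Finset.Icc 1 n, (if j ∈ I then (1 : ℝ) else 0) * w j = ∑ i ∈ I, w i := by
  simp only [ite_mul, one_mul, zero_mul]
  rw [← Finset.sum_filter, Finset.filter_mem_eq_inter, Finset.inter_eq_right.2 hI]

lemma sum_indicator_sq {I : Finset ℕ} (hI : I ⊆ Finset.Icc 1 n) :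
    ∑ j ∈ Finset.Icc 1 n, (if j ∈ I then (1 : ℝ) else 0) ^ 2 = I.card := by
  simp only [ite_pow, one_pow, ne_eq, OfNat.ofNat_ne_zero, not_false_eq_true, zero_pow]
  rw [← Finset.sum_filter, Finset.filter_mem_eq_inter, Finset.inter_eq_right.2 hI]
  simp

/-- Coefficients of the sum of the residuals over `I` as a linear form in the data. -/
def residCoeff (n : ℕ) (lam : ℝ) (I : Finset ℕ) (j : ℕ) : ℝ :=
  (if j ∈ I then 1 else 0) - ∑ i ∈ I, basisSpline n lam j (design n i)

lemma sum_resid_eq {I : Finset ℕ} (hI : I ⊆ Finset.Icc 1 n) (c : ℕ → ℝ) :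
    ∑ i ∈ I, (c i - ∑ j ∈ Finset.Icc 1 n, c j * basisSpline n lam j (design n i)) =
      ∑ j ∈ Finset.Icc 1 n, residCoeff n lam I j * c j := by
  simp only [residCoeff, sub_mul, Finset.sum_sub_distrib, Finset.sum_mul]
  congr 1
  · exact (sum_indicator_mul hI c).symm
  · rw [Finset.sum_comm]
    exact Finset.sum_congr rfl fun j _ => Finset.sum_congr rfl fun i _ => mul_comm _ _

/-- Since the smoother matrix is symmetric, the coefficients are the residuals of the spline for
the indicator of `I`, so that the contraction property bounds their sum of squares. -/
lemma sum_sq_residCoeff_le (hlam : 0 < lam) {I : Finset ℕ} (hI : I ⊆ Finset.Icc 1 n) :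
    ∑ j ∈ Finset.Icc 1 n, residCoeff n lam I j ^ 2 ≤ I.card := by
  have h1 := (isEqualSpline_sum_basisSpline (n := n) hlam.le
    (fun j => if j ∈ I then (1 : ℝ) else 0)).sum_sq_resid_le hlam
  rw [sum_indicator_sq hI] at h1
  refine le_trans (le_of_eq (Finset.sum_congr rfl fun j hj => ?_)) h1
  rw [residCoeff, sum_indicator_mul hI]
  congr 2
  exact Finset.sum_congr rfl fun i hi => basisSpline_symm hlam hj (hI hi)

end EqualWeights

/-! ### The diagonal of the smoother matrix -/

section Diagonal

variable {n N : ℕ} {lam : ℝ} {g : ℝ → ℝ}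

lemma sum_comp_le_of_injOn {F : ℕ → ℝ} (hF : ∀ i, 0 ≤ F i) {s t : Finset ℕ} {a : ℕ → ℕ}
    (ha : ∀ j ∈ s, a j ∈ t) (hinj : Set.InjOn a s) : ∑ j ∈ s, F (a j) ≤ ∑ i ∈ t, F i := by
  rw [← Finset.sum_image (f := F) hinj]
  exact Finset.sum_le_sum_of_subset_of_nonneg (Finset.image_subset_iff.2 ha) fun i _ _ => hF i

/-- A point value is controlled by `2 g(t + s) - g(t + 2 s)` and a second difference. -/
lemma sq_le_of_second_difference (hg : MemH2 g) {t s r : ℝ} (ht : t ∈ Icc (0 : ℝ) 1)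
    (hs : t + 2 * s ∈ Icc (0 : ℝ) 1) (hr : |s| ≤ r) :
    g t ^ 2 ≤ 12 * g (t + s) ^ 2 + 3 * g (t + 2 * s) ^ 2 + 75 * r ^ 3 * roughness g := by
  have h1 := abs_second_difference_le hg ht hs
  set e := g (t + 2 * s) - 2 * g (t + s) + g t with he
  have h2 : e ^ 2 ≤ 25 * r ^ 3 * roughness g := by
    have h3 : e ^ 2 ≤ (5 * (|s| * √|s|) * √(roughness g)) ^ 2 := by
      rw [← sq_abs e]
      exact pow_le_pow_left₀ (abs_nonneg _) h1 2
    have h4 : (5 * (|s| * √|s|) * √(roughness g)) ^ 2 = 25 * |s| ^ 3 * roughness g := by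
      have h5 := Real.sq_sqrt (abs_nonneg s)
      have h6 := Real.sq_sqrt (roughness_nonneg g)
      calc _ = 25 * (|s| ^ 2 * √|s| ^ 2) * √(roughness g) ^ 2 := by ring
        _ = _ := by rw [h5, h6]; ring
    rw [h4] at h3
    refine h3.trans ?_
    have := roughness_nonneg g
    gcongr
  have h7 : g t = 2 * g (t + s) - g (t + 2 * s) + e := by rw [he]; ring
  rw [h7]
  nlinarith [sq_nonneg (2 * g (t + s) + g (t + 2 * s)), sq_nonneg (2 * g (t + s) - e),
    sq_nonneg (g (t + 2 * s) + e)]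

/-- A discrete Sobolev inequality. Averaging `sq_le_of_second_difference` over `N` steps
directed to the far end point covers the points near the boundary as well. -/
lemma sq_design_le (hg : MemH2 g) (hN : 0 < N) (hNn : 4 * N ≤ n) {i : ℕ}
    (hi : i ∈ Finset.Icc 1 n) :
    g (design n i) ^ 2 ≤ 15 / N * ∑ j ∈ Finset.Icc 1 n, g (design n j) ^ 2 +
      75 * ((N : ℝ) / n) ^ 3 * roughness g := by
  have hn : (0 : ℝ) < n := by exact_mod_cast (by omega : 0 < n)
  have hN' : (0 : ℝ) < N := by exact_mod_cast hN
  set S := ∑ j ∈ Finset.Icc 1 n, g (design n j) ^ 2 with hS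
  set D := 75 * ((N : ℝ) / n) ^ 3 * roughness g with hD
  have hF : ∀ j, 0 ≤ g (design n j) ^ 2 := fun _ => sq_nonneg _
  obtain ⟨a, b, ha, hb, hai, hbi, H⟩ : ∃ a b : ℕ → ℕ,
      (∀ j ∈ Finset.Icc 1 N, a j ∈ Finset.Icc 1 n) ∧
      (∀ j ∈ Finset.Icc 1 N, b j ∈ Finset.Icc 1 n) ∧
      Set.InjOn a (Finset.Icc 1 N) ∧ Set.InjOn b (Finset.Icc 1 N) ∧
      ∀ j ∈ Finset.Icc 1 N, g (design n i) ^ 2 ≤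
        12 * g (design n (a j)) ^ 2 + 3 * g (design n (b j)) ^ 2 + D := by
    simp only [Finset.mem_Icc] at hi
    rcases le_or_gt (2 * i) n with h2i | h2i
    · have hb : ∀ j ∈ Finset.Icc 1 N, i + 2 * j ∈ Finset.Icc 1 n := fun j hj => by
        simp only [Finset.mem_Icc] at hj ⊢; omega
      refine ⟨fun j => i + j, fun j => i + 2 * j, fun j hj => ?_, hb, ?_, ?_, fun j hj => ?_⟩
      · simp only [Finset.mem_Icc] at hj ⊢; omega
      · intro j _ l _ hjl; simp only at hjl; omega
      · intro j _ l _ hjl; simp only at hjl; omega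
      · have e1 : design n (i + j) = design n i + (j : ℝ) / n := by
          simp only [design]; push_cast; ring
        have e2 : design n (i + 2 * j) = design n i + 2 * ((j : ℝ) / n) := by
          simp only [design]; push_cast; ring
        have h3 := design_mem (hb j hj)
        rw [e1, e2]
        rw [e2] at h3
        refine sq_le_of_second_difference hg (design_mem (Finset.mem_Icc.2 hi)) h3 ?_
        rw [abs_of_nonneg (by positivity)]
        have : j ≤ N := (Finset.mem_Icc.1 hj).2
        gcongr
    · have hb : ∀ j ∈ Finset.Icc 1 N, i - 2 * j ∈ Finset.Icc 1 n := fun j hj => by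
        simp only [Finset.mem_Icc] at hj ⊢; omega
      refine ⟨fun j => i - j, fun j => i - 2 * j, fun j hj => ?_, hb, ?_, ?_, fun j hj => ?_⟩
      · simp only [Finset.mem_Icc] at hj ⊢; omega
      · intro j hj l hl hjl
        simp only [Finset.coe_Icc, Set.mem_Icc] at hjl hj hl; omega
      · intro j hj l hl hjl
        simp only [Finset.coe_Icc, Set.mem_Icc] at hjl hj hl; omega
      · have hjN : j ≤ N := (Finset.mem_Icc.1 hj).2
        have e1 : design n (i - j) = design n i + -((j : ℝ) / n) := by
          simp only [design]; rw [Nat.cast_sub (by omega)]; ring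
        have e2 : design n (i - 2 * j) = design n i + 2 * -((j : ℝ) / n) := by
          simp only [design]; rw [Nat.cast_sub (by omega)]; push_cast; ring
        have h3 := design_mem (hb j hj)
        rw [e1, e2]
        rw [e2] at h3
        refine sq_le_of_second_difference hg (design_mem (Finset.mem_Icc.2 hi)) h3 ?_
        rw [abs_neg, abs_of_nonneg (by positivity)]
        gcongr
  have h1 := Finset.sum_le_sum H
  rw [Finset.sum_add_distrib, Finset.sum_add_distrib, ← Finset.mul_sum, ← Finset.mul_sum,
    Finset.sum_const, Finset.sum_const, Nat.card_Icc, Nat.add_sub_cancel, nsmul_eq_mul,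
    nsmul_eq_mul] at h1
  have h2 := sum_comp_le_of_injOn hF ha hai
  have h3 := sum_comp_le_of_injOn hF hb hbi
  have h4 : N * g (design n i) ^ 2 ≤ 15 * S + N * D := by linarith
  calc g (design n i) ^ 2 = N * g (design n i) ^ 2 / N := by field_simp
    _ ≤ (15 * S + N * D) / N := by gcongr
    _ = _ := by field_simp

/-- The diagonal entries of the smoother matrix are at most `15 / N`, where `N` is of the order
of the number of design points in a bandwidth. -/
lemma basisSpline_diag_le (hlam : 0 < lam) (hN : 0 < N) (hNn : 4 * N ≤ n)
    (hNlam : 5 * (N : ℝ) ^ 4 * lam ≤ (n : ℝ) ^ 3) {i : ℕ} (hi : i ∈ Finset.Icc 1 n) :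
    basisSpline n lam i (design n i) ≤ 15 / N := by
  have hn : (0 : ℝ) < n := by exact_mod_cast (by omega : 0 < n)
  have hN' : (0 : ℝ) < N := by exact_mod_cast hN
  have h1 := sq_design_le (isEqualSpline_basisSpline n hlam.le i).1 hN hNn hi
  have h2 := roughness_basisSpline hlam.le hi
  have h3 := roughness_nonneg (basisSpline n lam i)
  set x := basisSpline n lam i (design n i)
  set S := ∑ j ∈ Finset.Icc 1 n, basisSpline n lam i (design n j) ^ 2
  set R := roughness (basisSpline n lam i)
  have hS : S ≤ x := by
    rw [h2] at h3
    linarith [nonneg_of_mul_nonneg_right h3 hlam]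
  have hS0 : 0 ≤ S := Finset.sum_nonneg fun _ _ => sq_nonneg _
  have h4 : 75 * ((N : ℝ) / n) ^ 3 * R ≤ 15 / N * (x - S) := by
    have h5 : 75 * ((N : ℝ) / n) ^ 3 * R = 15 / N * (5 * N ^ 4 * lam / n ^ 3) * (x - S) := by
      rw [h2]; field_simp; ring
    rw [h5]
    have h6 : 5 * (N : ℝ) ^ 4 * lam / n ^ 3 ≤ 1 := div_le_one_of_le₀ hNlam (by positivity)
    have h7 : 0 ≤ x - S := by linarith
    refine mul_le_mul_of_nonneg_right ?_ h7
    exact mul_le_of_le_one_right (by positivity) h6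
  have h8 : x * x ≤ 15 / N * x := by nlinarith
  rcases (hS0.trans hS).eq_or_lt with h9 | h9
  · rw [← h9]; positivity
  · exact le_of_mul_le_mul_right h8 h9

lemma roughness_basisSpline_le (hlam : 0 < lam) (hN : 0 < N) (hNn : 4 * N ≤ n)
    (hNlam : 5 * (N : ℝ) ^ 4 * lam ≤ (n : ℝ) ^ 3) {i : ℕ} (hi : i ∈ Finset.Icc 1 n) :
    roughness (basisSpline n lam i) ≤ lam * (15 / N) := by
  rw [roughness_basisSpline hlam.le hi]
  have h1 := basisSpline_diag_le hlam hN hNn hNlam hi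
  have h2 : 0 ≤ ∑ j ∈ Finset.Icc 1 n, basisSpline n lam i (design n j) ^ 2 :=
    Finset.sum_nonneg fun _ _ => sq_nonneg _
  gcongr
  linarith

end Diagonal

/-! ### The selected splines -/

section Selection

variable {n : ℕ} {lam lam' : ℝ} {y : ℕ → ℝ} {g g' : ℝ → ℝ}

lemma block_subset (n k m : ℕ) : block n k m ⊆ Finset.Icc 1 n := by
  intro i hi
  simp only [block, Finset.mem_Ioc, le_min_iff, Finset.mem_Icc] at hi ⊢
  omega

/-- A normalized sum is at most the Euclidean norm. -/
lemma abs_sum_div_sqrt_card_le {I s : Finset ℕ} (hI : I ⊆ s) (a : ℕ → ℝ) :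
    |(∑ i ∈ I, a i) / √(I.card : ℝ)| ≤ √(∑ i ∈ s, a i ^ 2) := by
  have h1 : |∑ i ∈ I, a i| ≤ √(I.card : ℝ) * √(∑ i ∈ s, a i ^ 2) := by
    rw [← Real.sqrt_mul (by positivity)]
    refine Real.abs_le_sqrt (sq_sum_le_card_mul_sum_sq.trans ?_)
    gcongr
  rw [abs_div, abs_of_nonneg (Real.sqrt_nonneg _)]
  exact div_le_of_le_mul₀ (Real.sqrt_nonneg _) (Real.sqrt_nonneg _) (by rwa [mul_comm])

lemma abs_resid_le_add {I : Finset ℕ} (hI : I ⊆ Finset.Icc 1 n) :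
    |resid n y I g| ≤ |resid n y I g'| +
      √(∑ i ∈ Finset.Icc 1 n, (g (design n i) - g' (design n i)) ^ 2) := by
  have h1 : resid n y I g = resid n y I g' -
      (∑ i ∈ I, (g (design n i) - g' (design n i))) / √(I.card : ℝ) := by
    unfold resid
    rw [← sub_div, ← Finset.sum_sub_distrib]
    congr 1
    exact Finset.sum_congr rfl fun i _ => by ring
  rw [h1]
  exact (abs_sub _ _).trans (add_le_add le_rfl (abs_sum_div_sqrt_card_le hI _))

lemma equalSpline_of_pos (n : ℕ) (y : ℕ → ℝ) (hlam : 0 < lam) :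
    IsEqualSpline n lam y (equalSpline n y lam) := by
  rw [equalSpline, if_neg hlam.ne']
  exact isWeightedSpline_weightedSpline n (fun _ => hlam.le) y

lemma equalSpline_zero (n : ℕ) (y : ℕ → ℝ) : equalSpline n y 0 = lsLine n y := if_pos rfl

lemma memH2_equalSpline (n : ℕ) (y : ℕ → ℝ) (hlam : 0 ≤ lam) : MemH2 (equalSpline n y lam) := by
  rcases hlam.eq_or_lt with rfl | h
  · rw [equalSpline_zero]; exact memH2_lsLine n y
  · exact (equalSpline_of_pos n y h).1

lemma roughness_equalSpline_mono (n : ℕ) (y : ℕ → ℝ) (hlam : 0 ≤ lam) (hle : lam ≤ lam') :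
    roughness (equalSpline n y lam) ≤ roughness (equalSpline n y lam') := by
  rcases hlam.eq_or_lt with rfl | h
  · rw [equalSpline_zero, roughness_lsLine]; exact roughness_nonneg _
  · exact (equalSpline_of_pos n y h).roughness_mono (equalSpline_of_pos n y (h.trans_le hle)) h hle

lemma le_of_sq_le_mul_sqrt {P a : ℝ} (hP : 0 ≤ P) (ha : 0 ≤ a) (h : P ≤ a * √P) : √P ≤ a := by
  rcases (Real.sqrt_nonneg P).eq_or_lt with h0 | h0
  · rwa [← h0]
  · refine le_of_mul_le_mul_right ?_ h0
    rwa [Real.mul_self_sqrt hP]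

lemma sqrt_sum_sq_sub_le (hs : IsEqualSpline n lam y g) (hs' : IsEqualSpline n lam' y g')
    (hlam : 0 < lam) (hlam' : 0 < lam') :
    √(∑ i ∈ Finset.Icc 1 n, (g (design n i) - g' (design n i)) ^ 2) ≤
      |lam - lam'| / lam' * √(∑ i ∈ Finset.Icc 1 n, y i ^ 2) := by
  have h1 := hs.sum_sq_sub_le hs'
  set P := ∑ i ∈ Finset.Icc 1 n, (g (design n i) - g' (design n i)) ^ 2 with hP
  have hP0 : 0 ≤ P := Finset.sum_nonneg fun _ _ => sq_nonneg _
  refine le_of_sq_le_mul_sqrt hP0 (by positivity) ?_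
  have h2 : |∑ i ∈ Finset.Icc 1 n, (y i - g (design n i)) * (g (design n i) - g' (design n i))| ≤
      √(∑ i ∈ Finset.Icc 1 n, y i ^ 2) * √P := by
    rw [← Real.sqrt_mul (Finset.sum_nonneg fun _ _ => sq_nonneg _)]
    refine Real.abs_le_sqrt ((Finset.sum_mul_sq_le_sq_mul_sq _ _ _).trans ?_)
    exact mul_le_mul_of_nonneg_right (hs.sum_sq_resid_le hlam) hP0
  have h3 : lam' * P ≤ |lam - lam'| * (√(∑ i ∈ Finset.Icc 1 n, y i ^ 2) * √P) := by
    refine h1.trans ((le_abs_self _).trans ?_)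
    rw [abs_mul]
    gcongr
  calc P = lam' * P / lam' := by field_simp
    _ ≤ |lam - lam'| * (√(∑ i ∈ Finset.Icc 1 n, y i ^ 2) * √P) / lam' := by gcongr
    _ = _ := by ring

/-- As the weight tends to zero the roughness of the spline tends to zero, so that the spline is
close to an affine function; and both the spline and the least squares line have residuals
orthogonal to the affine functions. -/
lemma sqrt_sum_sq_sub_lsLine_le (hs : IsEqualSpline n lam y g) (hlam : 0 < lam) :
    √(∑ i ∈ Finset.Icc 1 n, (g (design n i) - lsLine n y (design n i)) ^ 2) ≤
      √(n * (lam * ∑ i ∈ Finset.Icc 1 n, (y i - lsLine n y (design n i)) ^ 2)) := by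
  obtain ⟨h, hg⟩ := hs.1
  obtain ⟨g₁, hT⟩ := exists_taylor hs.1
  set ℓ := lsLine n y with hℓ
  obtain ⟨p, r, hpr⟩ : ∃ p r : ℝ, ∀ t, ℓ t = p + r * t := ⟨_, _, fun t => rfl⟩
  set Q := ∑ i ∈ Finset.Icc 1 n, (y i - ℓ (design n i)) ^ 2 with hQ
  set P := ∑ i ∈ Finset.Icc 1 n, (g (design n i) - ℓ (design n i)) ^ 2 with hP
  have hP0 : 0 ≤ P := Finset.sum_nonneg fun _ _ => sq_nonneg _
  have hR : roughness g ≤ lam * Q := by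
    have h1 := hs.le (memH2_lsLine n y)
    rw [roughness_lsLine, add_zero] at h1
    have h2 : 0 ≤ ∑ i ∈ Finset.Icc 1 n, (y i - g (design n i)) ^ 2 :=
      Finset.sum_nonneg fun _ _ => sq_nonneg _
    nlinarith [mul_nonneg hlam.le h2]
  have horth : ∀ a b : ℝ, ∑ i ∈ Finset.Icc 1 n,
      (g (design n i) - ℓ (design n i)) * (a + b * design n i) = 0 := by
    intro a b
    have h1 := hs.normal_eq hg (hasSecondDeriv_affine a b)
    simp only [mul_zero, intervalIntegral.integral_zero, mul_eq_zero, hlam.ne', false_or] at h1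
    have h2 := lsLine_normal_eq n y a b
    rw [← sub_zero (0 : ℝ)]
    nth_rewrite 1 [← h2]
    rw [← h1, ← Finset.sum_sub_distrib]
    exact Finset.sum_congr rfl fun i _ => by ring
  refine le_of_sq_le_mul_sqrt hP0 (Real.sqrt_nonneg _) ?_
  have h1 : P = ∑ i ∈ Finset.Icc 1 n, (g (design n i) - ℓ (design n i)) *
      (g (design n i) - g 0 - g₁ 0 * (design n i - 0)) := by
    have h2 := horth (g 0 - p) (g₁ 0 - r)
    refine sub_eq_zero.1 (Eq.trans ?_ h2)
    rw [hP, ← Finset.sum_sub_distrib]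
    refine Finset.sum_congr rfl fun i _ => ?_
    rw [hpr]
    ring
  have h3 : ∑ i ∈ Finset.Icc 1 n, (g (design n i) - g 0 - g₁ 0 * (design n i - 0)) ^ 2 ≤
      n * (lam * Q) := by
    have h4 : ∀ i ∈ Finset.Icc 1 n,
        (g (design n i) - g 0 - g₁ 0 * (design n i - 0)) ^ 2 ≤ lam * Q := by
      intro i hi
      have hd := design_mem hi
      have h5 := hT 0 (by simp) _ hd
      have h6 : |design n i - 0| ≤ 1 := by
        rw [sub_zero, abs_of_nonneg hd.1]; exact hd.2
      have h7 : |design n i - 0| * √|design n i - 0| * √(roughness g) ≤ √(roughness g) := by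
        refine mul_le_of_le_one_left (Real.sqrt_nonneg _) ?_
        exact mul_le_one₀ h6 (Real.sqrt_nonneg _) (Real.sqrt_le_one.2 h6)
      rw [← sq_abs]
      calc _ ≤ √(roughness g) ^ 2 := pow_le_pow_left₀ (abs_nonneg _) (h5.trans h7) 2
        _ = roughness g := Real.sq_sqrt (roughness_nonneg g)
        _ ≤ _ := hR
    have h8 := Finset.sum_le_sum h4
    simpa using h8
  have h9 : P ≤ √(P * (n * (lam * Q))) := by
    refine (le_abs_self _).trans (Real.abs_le_sqrt ?_)
    nth_rewrite 1 [h1]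
    exact (Finset.sum_mul_sq_le_sq_mul_sq _ _ _).trans (mul_le_mul_of_nonneg_left h3 hP0)
  rwa [Real.sqrt_mul hP0, mul_comm] at h9

/-- The fitted values of the equal-weight spline are right-continuous functions of the weight,
including weight zero. -/
lemma exists_forall_sqrt_sum_sq_sub_lt (n : ℕ) (y : ℕ → ℝ) (hlam' : 0 ≤ lam') {ε : ℝ}
    (hε : 0 < ε) : ∃ η > 0, ∀ lam, lam' ≤ lam → |lam - lam'| < η →
      √(∑ i ∈ Finset.Icc 1 n,
        (equalSpline n y lam' (design n i) - equalSpline n y lam (design n i)) ^ 2) < ε := by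
  obtain ⟨b, hb, hb0, hle⟩ : ∃ b : ℝ → ℝ, Continuous b ∧ b lam' = 0 ∧ ∀ lam, 0 < lam →
      √(∑ i ∈ Finset.Icc 1 n,
        (equalSpline n y lam (design n i) - equalSpline n y lam' (design n i)) ^ 2) ≤ b lam := by
    rcases hlam'.eq_or_lt with rfl | h
    · refine ⟨fun lam => √(n * (lam * ∑ i ∈ Finset.Icc 1 n, (y i - lsLine n y (design n i)) ^ 2)),
        by fun_prop, by simp, fun lam hl => ?_⟩
      rw [equalSpline_zero]
      exact sqrt_sum_sq_sub_lsLine_le (equalSpline_of_pos n y hl) hl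
    · exact ⟨fun lam => |lam - lam'| / lam' * √(∑ i ∈ Finset.Icc 1 n, y i ^ 2), by fun_prop,
        by simp, fun lam hl =>
          sqrt_sum_sq_sub_le (equalSpline_of_pos n y hl) (equalSpline_of_pos n y h) hl h⟩
  obtain ⟨η, hη, H⟩ := Metric.continuous_iff.1 hb lam' ε hε
  refine ⟨η, hη, fun lam hl hd => ?_⟩
  rcases hl.eq_or_lt with rfl | hlt
  · simpa using hε
  have hsymm : ∑ i ∈ Finset.Icc 1 n,
      (equalSpline n y lam' (design n i) - equalSpline n y lam (design n i)) ^ 2 =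
      ∑ i ∈ Finset.Icc 1 n,
      (equalSpline n y lam (design n i) - equalSpline n y lam' (design n i)) ^ 2 :=
    Finset.sum_congr rfl fun i _ => by ring
  rw [hsymm]
  have h2 := H lam (by rwa [Real.dist_eq])
  rw [hb0, Real.dist_eq, sub_zero] at h2
  exact (hle lam (hlam'.trans_lt hlt)).trans_lt ((le_abs_self _).trans_lt h2)

/-- A smallest weight with spline in the region exists as soon as there is any such weight. -/
lemma exists_isLeast (n : ℕ) (y : ℕ → ℝ) (hlam : 0 ≤ lam)
    (hmem : equalSpline n y lam ∈ region n y) :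
    ∃ l, IsLeast {l : ℝ | 0 ≤ l ∧ equalSpline n y l ∈ region n y} l := by
  set Λ := {l : ℝ | 0 ≤ l ∧ equalSpline n y l ∈ region n y} with hΛ
  have hne : Λ.Nonempty := ⟨lam, hlam, hmem⟩
  have hbdd : BddBelow Λ := ⟨0, fun l hl => hl.1⟩
  have h0 : 0 ≤ sInf Λ := Real.sInf_nonneg fun l hl => hl.1
  refine ⟨sInf Λ, ⟨h0, fun k m => ?_⟩, fun l hl => csInf_le hbdd hl⟩
  refine le_of_forall_pos_le_add fun ε hε => ?_
  obtain ⟨η, hη, H⟩ := exists_forall_sqrt_sum_sq_sub_lt n y h0 hε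
  obtain ⟨l, hl, hd⟩ := Metric.mem_closure_iff.1 (csInf_mem_closure hne hbdd) η hη
  have h1 := H l (csInf_le hbdd hl) (by rwa [abs_sub_comm, ← Real.dist_eq])
  exact (abs_resid_le_add (g' := equalSpline n y l) (block_subset n k m)).trans
    (add_le_add (hl.2 k m) h1.le)

/-- The equal-weight fit lies in the region and is at most as rough as any equal-weight spline in
the region. -/
lemma equalFit_spec (hlam : 0 ≤ lam) (hmem : equalSpline n y lam ∈ region n y) :
    equalFit n y ∈ region n y ∧ MemH2 (equalFit n y) ∧
      roughness (equalFit n y) ≤ roughness (equalSpline n y lam) := by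
  have hl := Classical.epsilon_spec (exists_isLeast n y hlam hmem)
  exact ⟨hl.1.2, memH2_equalSpline n y hl.1.1,
    roughness_equalSpline_mono n y hl.1.1 (hl.2 ⟨hlam, hmem⟩)⟩

lemma weightSeq_nonneg {q l : ℝ} (hq : 0 ≤ q) (hl : 0 ≤ l) (n : ℕ) (y : ℕ → ℝ) (j i : ℕ) :
    0 ≤ weightSeq q l n y j i := by
  induction j with
  | zero => exact hl
  | succ j ih =>
    simp only [weightSeq]
    split_ifs
    · exact mul_nonneg hq ih
    · exact ih

lemma memH2_weightedFit {q l : ℝ} (hq : 0 ≤ q) (hl : 0 ≤ l) (n : ℕ) (y : ℕ → ℝ) :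
    MemH2 (weightedFit q l n y) := by
  rw [weightedFit]
  split_ifs
  · exact memH2_lsLine n y
  · exact (isWeightedSpline_weightedSpline n (weightSeq_nonneg hq hl n y _) y).1

lemma modifiedEstimate_spec {q l : ℝ} (hq : 0 ≤ q) (hl : 0 ≤ l) (hlam : 0 ≤ lam)
    (hmem : equalSpline n y lam ∈ region n y) :
    modifiedEstimate q l n y ∈ region n y ∧ MemH2 (modifiedEstimate q l n y) ∧
      roughness (modifiedEstimate q l n y) ≤ roughness (equalSpline n y lam) := by
  obtain ⟨h1, h2, h3⟩ := equalFit_spec hlam hmem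
  rw [modifiedEstimate]
  split_ifs with h
  · exact ⟨h.1, memH2_weightedFit hq hl n y, h.2.trans h3⟩
  · exact ⟨h1, h2, h3⟩

end Selection

/-! ### From block sums to point values -/

section Local

variable {n k : ℕ} {u : ℝ → ℝ}

lemma card_block {m : ℕ} (hm : (m + 1) * 2 ^ k ≤ n) : (block n k m).card = 2 ^ k := by
  rw [block, min_eq_left hm, Nat.card_Ioc]
  rw [add_mul, one_mul, Nat.add_sub_cancel_left]

/-- A function with small sums over dyadic blocks is small at interior points. By Taylor's formula
at `t` the sum over the block on the side of `t` to which the tangent does not decrease is at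
least `2 ^ k` times `u t` up to the remainder. -/
lemma le_of_block_sums (hu : MemH2 u) {D t : ℝ} (hn : 0 < n)
    (hb : ∀ m, (m + 1) * 2 ^ k ≤ n → |∑ i ∈ block n k m, u (design n i)| ≤ D * √(2 ^ k : ℝ))
    (ht0 : 2 * 2 ^ k ≤ n * t) (ht1 : n * t + 2 * 2 ^ k ≤ n) :
    u t ≤ D / √(2 ^ k : ℝ) +
      (2 * 2 ^ k / n) * √(2 * 2 ^ k / n : ℝ) * √(roughness u) := by
  have hn' : (0 : ℝ) < n := by exact_mod_cast hn
  set K : ℝ := 2 ^ k with hK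
  have hKpos : 0 < K := by positivity
  have ht : t ∈ Icc (0 : ℝ) 1 := by
    constructor
    · by_contra! h
      nlinarith
    · by_contra! h
      nlinarith
  obtain ⟨u₁, hT⟩ := exists_taylor hu
  set ρ := (2 * K / n) * √(2 * K / n) * √(roughness u) with hρ
  -- The block index of `n t`; the neighbouring blocks lie on either side of `t`.
  obtain ⟨m, hm0, hm1⟩ : ∃ m : ℕ, (m : ℝ) * K ≤ n * t ∧ n * t < (m + 1) * K := by
    refine ⟨⌊n * t / K⌋₊, ?_, ?_⟩
    · rw [← le_div_iff₀ hKpos]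
      exact Nat.floor_le (div_nonneg (mul_nonneg hn'.le ht.1) hKpos.le)
    · rw [← div_lt_iff₀ hKpos]
      exact Nat.lt_floor_add_one _
  have hm : 1 ≤ m := by
    by_contra! h
    have : m = 0 := by omega
    subst this
    simp at hm1
    linarith
  obtain ⟨m', hm', H⟩ : ∃ m', (m' + 1) * 2 ^ k ≤ n ∧ ∀ i ∈ block n k m',
      |design n i - t| ≤ 2 * K / n ∧ 0 ≤ u₁ t * (design n i - t) := by
    rcases le_total 0 (u₁ t) with h | h
    · have hle : (m + 1 + 1) * 2 ^ k ≤ n := by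
        have : ((m : ℝ) + 1 + 1) * 2 ^ k ≤ n := by rw [← hK]; nlinarith
        exact_mod_cast this
      refine ⟨m + 1, hle, fun i hi => ?_⟩
      rw [block, min_eq_left hle, Finset.mem_Ioc] at hi
      have h1 : ((m : ℝ) + 1) * K ≤ i := by rw [hK]; exact_mod_cast hi.1.le
      have h2 : (i : ℝ) ≤ (m + 1 + 1) * K := by rw [hK]; exact_mod_cast hi.2
      have e : design n i - t = (i - n * t) / n := by rw [design]; field_simp
      have h3 : 0 ≤ (i : ℝ) - n * t := by linarith
      rw [e, abs_of_nonneg (by positivity)]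
      refine ⟨?_, by positivity⟩
      gcongr
      nlinarith
    · have hle : (m - 1 + 1) * 2 ^ k ≤ n := by
        rw [Nat.sub_add_cancel hm]
        have : (m : ℝ) * 2 ^ k ≤ n := by rw [← hK]; nlinarith
        exact_mod_cast this
      refine ⟨m - 1, hle, fun i hi => ?_⟩
      rw [block, min_eq_left hle, Finset.mem_Ioc, Nat.sub_add_cancel hm] at hi
      have h1 : ((m : ℝ) - 1) * K ≤ i := by
        have : (((m - 1 : ℕ) : ℝ)) * 2 ^ k ≤ i := by exact_mod_cast hi.1.le
        rwa [Nat.cast_sub hm, Nat.cast_one] at this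
      have h2 : (i : ℝ) ≤ m * K := by rw [hK]; exact_mod_cast hi.2
      have e : design n i - t = -((n * t - i) / n) := by rw [design]; field_simp; ring
      have h3 : 0 ≤ n * t - i := by linarith
      rw [e, abs_neg, abs_of_nonneg (by positivity)]
      refine ⟨?_, ?_⟩
      · gcongr
        nlinarith
      · rw [mul_neg, ← neg_mul]
        exact mul_nonneg (by linarith) (by positivity)
  have h1 : ∀ i ∈ block n k m', u t - ρ ≤ u (design n i) := by
    intro i hi
    obtain ⟨h2, h3⟩ := H i hi
    have h4 := hT t ht _ (design_mem (block_subset n k m' hi))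
    have h5 : |design n i - t| * √|design n i - t| * √(roughness u) ≤ ρ := by
      rw [hρ]
      gcongr
    have h6 := (abs_le.1 (h4.trans h5)).1
    linarith
  have h2 := Finset.card_nsmul_le_sum _ _ _ h1
  rw [card_block hm', nsmul_eq_mul] at h2
  push_cast at h2
  rw [← hK] at h2
  have h3 : K * (u t - ρ) ≤ D * √K := h2.trans ((le_abs_self _).trans (hb m' hm'))
  have h4 : D / √K = D * √K / K := by
    rw [mul_div_assoc, Real.sqrt_div_self, div_eq_mul_inv]
  have h5 : u t - ρ ≤ D / √K := by
    rw [h4, le_div_iff₀ hKpos]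
    linarith
  linarith

lemma abs_le_of_block_sums (hu : MemH2 u) {D t : ℝ} (hn : 0 < n)
    (hb : ∀ m, (m + 1) * 2 ^ k ≤ n → |∑ i ∈ block n k m, u (design n i)| ≤ D * √(2 ^ k : ℝ))
    (ht0 : 2 * 2 ^ k ≤ n * t) (ht1 : n * t + 2 * 2 ^ k ≤ n) :
    |u t| ≤ D / √(2 ^ k : ℝ) +
      (2 * 2 ^ k / n) * √(2 * 2 ^ k / n : ℝ) * √(roughness u) := by
  have h1 := le_of_block_sums (hu.const_mul (-1)) hn (D := D) (k := k) (t := t)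
    (fun m hm => by simpa [Finset.sum_neg_distrib] using hb m hm) ht0 ht1
  rw [roughness_const_mul hu, neg_one_sq, one_mul] at h1
  exact abs_le.2 ⟨by linarith, le_of_block_sums hu hn hb ht0 ht1⟩

/-- All blocks are among those with `k ≤ ⌈log₂ n⌉` and `m < n`, apart from the empty ones. -/
lemma block_eq_empty_or (hn : 0 < n) (k m : ℕ) : block n k m = ∅ ∨
    ∃ k' ≤ Nat.clog 2 n, ∃ m' < n, block n k m = block n k' m' := by
  rcases le_or_gt n m with h | h
  · left
    rw [block, Finset.Ioc_eq_empty]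
    have : m * 1 ≤ m * 2 ^ k := Nat.mul_le_mul_left _ Nat.one_le_two_pow
    omega
  rcases le_or_gt k (Nat.clog 2 n) with hk | hk
  · exact Or.inr ⟨k, hk, m, h, rfl⟩
  have h1 : n ≤ 2 ^ Nat.clog 2 n := Nat.le_pow_clog (by norm_num) n
  have h2 : n ≤ 2 ^ k := h1.trans (Nat.pow_le_pow_right (by norm_num) hk.le)
  rcases Nat.eq_zero_or_pos m with rfl | hm
  · right
    refine ⟨Nat.clog 2 n, le_rfl, 0, hn, ?_⟩
    simp [block, h1, h2]
  · left
    rw [block, Finset.Ioc_eq_empty]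
    have : 1 * 2 ^ k ≤ m * 2 ^ k := Nat.mul_le_mul_right _ hm
    omega

end Local

/-! ### The median -/

section Median

lemma card_le_two_mul_countP_of_median_lt {s : Multiset ℝ} {a : ℝ} (h : median s < a) :
    s.card ≤ 2 * s.countP (· < a) := by
  rcases Nat.eq_zero_or_pos s.card with h0 | h0
  · omega
  set l := s.sort (· ≤ ·) with hl
  have hlen : l.length = s.card := Multiset.length_sort _
  have hcoe : (l : Multiset ℝ) = s := Multiset.sort_eq _ _
  have hsort : l.Pairwise (· ≤ ·) := Multiset.pairwise_sort _ _
  have hmono : ∀ i j (hi : i < l.length) (hj : j < l.length), i ≤ j → l[i] ≤ l[j] := by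
    intro i j hi hj hij
    rcases hij.eq_or_lt with rfl | hlt
    · exact le_rfl
    · exact List.pairwise_iff_getElem.1 hsort i j hi hj hlt
  have h1 : (s.card - 1) / 2 < l.length := by omega
  have h2 : s.card / 2 < l.length := by omega
  have h3 : l[(s.card - 1) / 2] < a := by
    have h4 := hmono _ _ h1 h2 (by omega)
    rw [median, ← hl, List.getD_eq_getElem _ _ h1, List.getD_eq_getElem _ _ h2] at h
    linarith
  have h5 : (l.take ((s.card - 1) / 2 + 1)).countP (· < a) =
      (l.take ((s.card - 1) / 2 + 1)).length := by
    rw [List.countP_eq_length]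
    intro x hx
    obtain ⟨i, hi, rfl⟩ := List.getElem_of_mem hx
    rw [List.getElem_take]
    rw [List.length_take] at hi
    have : i < l.length := by omega
    exact decide_eq_true ((hmono i _ this h1 (by omega)).trans_lt h3)
  have h6 := (List.take_sublist ((s.card - 1) / 2 + 1) l).countP_le (p := fun x => decide (x < a))
  rw [h5, List.length_take] at h6
  rw [← hcoe, Multiset.coe_countP, hcoe]
  omega

lemma card_le_two_mul_countP_of_lt_median {s : Multiset ℝ} {a : ℝ} (h : a < median s) :
    s.card ≤ 2 * s.countP (a < ·) := by
  rcases Nat.eq_zero_or_pos s.card with h0 | h0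
  · omega
  set l := s.sort (· ≤ ·) with hl
  have hlen : l.length = s.card := Multiset.length_sort _
  have hcoe : (l : Multiset ℝ) = s := Multiset.sort_eq _ _
  have hsort : l.Pairwise (· ≤ ·) := Multiset.pairwise_sort _ _
  have hmono : ∀ i j (hi : i < l.length) (hj : j < l.length), i ≤ j → l[i] ≤ l[j] := by
    intro i j hi hj hij
    rcases hij.eq_or_lt with rfl | hlt
    · exact le_rfl
    · exact List.pairwise_iff_getElem.1 hsort i j hi hj hlt
  have h1 : (s.card - 1) / 2 < l.length := by omega
  have h2 : s.card / 2 < l.length := by omega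
  have h3 : a < l[s.card / 2] := by
    have h4 := hmono _ _ h1 h2 (by omega)
    rw [median, ← hl, List.getD_eq_getElem _ _ h1, List.getD_eq_getElem _ _ h2] at h
    linarith
  have h5 : (l.drop (s.card / 2)).countP (a < ·) = (l.drop (s.card / 2)).length := by
    rw [List.countP_eq_length]
    intro x hx
    obtain ⟨i, hi, rfl⟩ := List.getElem_of_mem hx
    rw [List.getElem_drop]
    rw [List.length_drop] at hi
    exact decide_eq_true (h3.trans_le (hmono _ _ h2 (by omega) (by omega)))
  have h6 := (List.drop_sublist (s.card / 2) l).countP_le (p := fun x => decide (a < x))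
  rw [h5, List.length_drop] at h6
  rw [← hcoe, Multiset.coe_countP, hcoe]
  omega

end Median

/-! ### Gaussian noise -/

section Noise

/-- The variables `W i`, `i ∈ s`, are independent standard Gaussian. -/
structure IsGaussianNoise {Ω : Type*} [MeasurableSpace Ω] (μ : Measure Ω) (s : Finset ℕ)
    (W : ℕ → Ω → ℝ) : Prop where
  law : ∀ i ∈ s, HasLaw (W i) (gaussianReal 0 1) μ
  indep : iIndepFun (fun i : s => W i) μ

variable {Ω : Type*} [MeasurableSpace Ω] {μ : Measure Ω}
  {s : Finset ℕ} {W : ℕ → Ω → ℝ}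

lemma IsGaussianNoise.hasSubgaussianMGF (hW : IsGaussianNoise μ s W) {i : ℕ} (hi : i ∈ s) :
    HasSubgaussianMGF (W i) 1 μ where
  integrable_exp_mul t := by
    have h1 := hW.law i hi
    have h2 := integrable_exp_mul_gaussianReal (μ := 0) (v := 1) t
    rw [← h1.map_eq] at h2
    exact h2.comp_aemeasurable h1.aemeasurable
  mgf_le t := by
    rw [mgf_gaussianReal (hW.law i hi).map_eq]
    simp

lemma IsGaussianNoise.memLp (hW : IsGaussianNoise μ s W) {i : ℕ} (hi : i ∈ s) :
    MemLp (W i) 2 μ :=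
  (hW.hasSubgaussianMGF hi).memLp 2

lemma IsGaussianNoise.integral_eq (hW : IsGaussianNoise μ s W) {i : ℕ} (hi : i ∈ s) :
    ∫ ω, W i ω ∂μ = 0 := by
  rw [(hW.law i hi).integral_eq, integral_id_gaussianReal]

lemma IsGaussianNoise.integral_sq (hW : IsGaussianNoise μ s W) {i : ℕ} (hi : i ∈ s) :
    ∫ ω, W i ω * W i ω ∂μ = 1 := by
  have h1 := (hW.law i hi).variance_eq
  rw [variance_id_gaussianReal, variance_of_integral_eq_zero (hW.law i hi).aemeasurable
    (hW.integral_eq hi)] at h1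
  simpa [sq] using h1

lemma IsGaussianNoise.indepFun (hW : IsGaussianNoise μ s W) {i j : ℕ} (hi : i ∈ s) (hj : j ∈ s)
    (hij : i ≠ j) : IndepFun (W i) (W j) μ :=
  hW.indep.indepFun (i := ⟨i, hi⟩) (j := ⟨j, hj⟩) fun h => hij (congrArg Subtype.val h)

lemma IsGaussianNoise.integral_mul (hW : IsGaussianNoise μ s W) {i j : ℕ} (hi : i ∈ s)
    (hj : j ∈ s) (hij : i ≠ j) : ∫ ω, W i ω * W j ω ∂μ = 0 := by
  rw [(hW.indepFun hi hj hij).integral_fun_mul_eq_mul_integral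
    (hW.memLp hi).aestronglyMeasurable (hW.memLp hj).aestronglyMeasurable, hW.integral_eq hi,
    zero_mul]

/-- Gaussian tail bound for a linear form with coefficient vector in the unit ball. -/
lemma IsGaussianNoise.measure_lt_abs_sum_le [IsFiniteMeasure μ] (hW : IsGaussianNoise μ s W)
    {a : ℕ → ℝ} (ha : ∑ i ∈ s, a i ^ 2 ≤ 1) {x : ℝ} (hx : 0 ≤ x) :
    μ {ω | x < |∑ i ∈ s, a i * W i ω|} ≤ ENNReal.ofReal (2 * Real.exp (-x ^ 2 / 2)) := by
  have h1 : iIndepFun (fun (i : s) ω => a i * W i ω) μ :=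
    hW.indep.comp (fun (i : s) x => a i * x) fun i => by fun_prop
  have h2 := HasSubgaussianMGF.sum_of_iIndepFun h1 (s := Finset.univ) fun i _ =>
    (hW.hasSubgaussianMGF i.2).const_mul (a i)
  simp only [fun ω => Finset.sum_coe_sort s (fun i => a i * W i ω)] at h2
  have h3 : HasSubgaussianMGF (fun ω => ∑ i ∈ s, a i * W i ω) 1 μ := by
    refine ⟨h2.integrable_exp_mul, fun t => ?_⟩
    · refine (h2.mgf_le t).trans (Real.exp_le_exp.2 ?_)
      refine div_le_div_of_nonneg_right (mul_le_mul_of_nonneg_right ?_ (sq_nonneg t)) zero_le_two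
      rw [NNReal.coe_sum, NNReal.coe_one]
      change ∑ i : s, a i ^ 2 * (1 : ℝ) ≤ 1
      simp only [mul_one]
      rwa [Finset.sum_coe_sort s (fun i => a i ^ 2)]
  have h6 : {ω | x < |∑ i ∈ s, a i * W i ω|} ⊆
      {ω | x ≤ ∑ i ∈ s, a i * W i ω} ∪ {ω | x ≤ (-fun ω => ∑ i ∈ s, a i * W i ω) ω} := by
    intro ω hω
    rcases lt_abs.1 (mem_ofPred_eq ▸ hω) with h | h
    · exact Or.inl h.le
    · exact Or.inr h.le
  have h7 := h3.measure_ge_le hx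
  have h8 := h3.neg.measure_ge_le hx
  simp only [NNReal.coe_one, mul_one] at h7 h8
  refine (measure_mono h6).trans ((measure_union_le _ _).trans ?_)
  rw [two_mul, ENNReal.ofReal_add (Real.exp_pos _).le (Real.exp_pos _).le]
  refine add_le_add ?_ ?_
  · rw [← ofReal_measureReal]
    exact ENNReal.ofReal_le_ofReal h7
  · rw [← ofReal_measureReal]
    exact ENNReal.ofReal_le_ofReal h8

/-- Union bound over a finite family of linear forms. -/
lemma IsGaussianNoise.measure_exists_lt_abs_sum_le [IsFiniteMeasure μ]
    (hW : IsGaussianNoise μ s W) {ι : Type*} (T : Finset ι) {a : ι → ℕ → ℝ}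
    (ha : ∀ p ∈ T, ∑ i ∈ s, a p i ^ 2 ≤ 1) {x : ℝ} (hx : 0 ≤ x) :
    μ {ω | ∃ p ∈ T, x < |∑ i ∈ s, a p i * W i ω|} ≤
      ENNReal.ofReal (T.card * (2 * Real.exp (-x ^ 2 / 2))) := by
  have h1 : {ω | ∃ p ∈ T, x < |∑ i ∈ s, a p i * W i ω|} =
      ⋃ p ∈ T, {ω | x < |∑ i ∈ s, a p i * W i ω|} := by
    ext ω; simp
  rw [h1]
  refine (measure_biUnion_finset_le _ _).trans ?_
  refine (Finset.sum_le_card_nsmul _ _ _ fun p hp => hW.measure_lt_abs_sum_le (ha p hp) hx).trans ?_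
  rw [nsmul_eq_mul, ENNReal.ofReal_mul (Nat.cast_nonneg _), ENNReal.ofReal_natCast]

lemma measure_le_of_integral_le [IsFiniteMeasure μ] {X : Ω → ℝ} (hX : Integrable X μ)
    (h0 : ∀ ω, 0 ≤ X ω) {E c : ℝ} (hE : ∫ ω, X ω ∂μ ≤ E) (hc : 0 < c) :
    μ {ω | c ≤ X ω} ≤ ENNReal.ofReal (E / c) := by
  have h1 := mul_meas_ge_le_integral_of_nonneg (Eventually.of_forall h0) hX c
  rw [← ofReal_measureReal]
  refine ENNReal.ofReal_le_ofReal ?_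
  rw [le_div_iff₀ hc, mul_comm]
  exact h1.trans hE

/-- For a linear combination with Gaussian coefficients the mean roughness is the sum of the
roughnesses. -/
lemma IsGaussianNoise.measure_le_roughness_sum [IsFiniteMeasure μ] (hW : IsGaussianNoise μ s W)
    {G : ℕ → ℝ → ℝ} (hG : ∀ i ∈ s, MemH2 (G i)) {c : ℝ} (hc : 0 < c) :
    μ {ω | c ≤ roughness (fun t => ∑ i ∈ s, W i ω * G i t)} ≤
      ENNReal.ofReal ((∑ i ∈ s, roughness (G i)) / c) := by
  choose! H hH using hG
  have hexp : ∀ ω, roughness (fun t => ∑ i ∈ s, W i ω * G i t) =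
      ∑ i ∈ s, ∑ j ∈ s, W i ω * W j ω * ∫ t in (0 : ℝ)..1, H i t * H j t := by
    intro ω
    have hint : ∀ i ∈ s, ∀ j ∈ s, IntervalIntegrable
        (fun t => W i ω * W j ω * (H i t * H j t)) volume 0 1 := fun i hi j hj =>
      (memLp_mul_intervalIntegrable (hH i hi).1 (hH j hj).1 (by simp) (by simp)).const_mul _
    rw [(HasSecondDeriv.sum s (fun i => W i ω) hH).roughness_eq]
    calc ∫ t in (0 : ℝ)..1, (∑ i ∈ s, W i ω * H i t) ^ 2
        = ∫ t in (0 : ℝ)..1, ∑ i ∈ s, ∑ j ∈ s, W i ω * W j ω * (H i t * H j t) := by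
          congr 1
          ext t
          rw [sq, Finset.sum_mul_sum]
          exact Finset.sum_congr rfl fun i _ => Finset.sum_congr rfl fun j _ => by ring
      _ = _ := by
          rw [intervalIntegral.integral_finsetSum fun i hi => by
            simpa only [Finset.sum_fn] using
              IntervalIntegrable.sum s fun j hj => hint i hi j hj]
          refine Finset.sum_congr rfl fun i hi => ?_
          rw [intervalIntegral.integral_finsetSum (hint i hi)]
          exact Finset.sum_congr rfl fun j _ => intervalIntegral.integral_const_mul _ _
  have hprod : ∀ i ∈ s, ∀ j ∈ s, Integrable (fun ω => W i ω * W j ω) μ := fun i hi j hj =>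
    (hW.memLp hi).integrable_mul (hW.memLp hj)
  have hint : Integrable (fun ω => roughness (fun t => ∑ i ∈ s, W i ω * G i t)) μ := by
    simp only [hexp]
    exact integrable_finsetSum _ fun i hi => integrable_finsetSum _ fun j hj =>
      (hprod i hi j hj).mul_const _
  refine measure_le_of_integral_le hint (fun ω => roughness_nonneg _) (le_of_eq ?_) hc
  simp only [hexp]
  rw [integral_finsetSum _ fun i hi => integrable_finsetSum _ fun j hj =>
      (hprod i hi j hj).mul_const _]
  refine Finset.sum_congr rfl fun i hi => ?_
  rw [integral_finsetSum _ fun j hj => (hprod i hi j hj).mul_const _, Finset.sum_eq_single i]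
  · rw [integral_mul_const, hW.integral_sq hi, one_mul, (hH i hi).roughness_eq]
    simp only [sq]
  · intro j hj hji
    rw [integral_mul_const, hW.integral_mul hi hj hji.symm, zero_mul]
  · exact fun h => absurd hi h

end Noise

/-! ### The scale estimate -/

section Scale

variable {Ω : Type*} [MeasurableSpace Ω] {μ : Measure Ω}

/-- Chebyshev's inequality for `1`-dependent sequences with values in the unit interval. -/
lemma measure_le_sum_of_one_dependent [IsProbabilityMeasure μ]
    {s : Finset ℕ} (hs : s.Nonempty) {X : ℕ → Ω → ℝ}
    (hm : ∀ i ∈ s, AEStronglyMeasurable (X i) μ) (h0 : ∀ i ω, 0 ≤ X i ω) (h1 : ∀ i ω, X i ω ≤ 1)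
    (hind : ∀ i ∈ s, ∀ j ∈ s, i + 1 < j → IndepFun (X i) (X j) μ) {p η : ℝ}
    (hp : ∀ i ∈ s, ∫ ω, X i ω ∂μ ≤ p) (hη : 0 < η) :
    μ {ω | (p + η) * s.card ≤ ∑ i ∈ s, X i ω} ≤ ENNReal.ofReal (3 / (η ^ 2 * s.card)) := by
  have hcard : (0 : ℝ) < s.card := by exact_mod_cast hs.card_pos
  have hL : ∀ i ∈ s, MemLp (X i) 2 μ := fun i hi =>
    MemLp.of_bound (hm i hi) 1 (Eventually.of_forall fun ω => by
      rw [Real.norm_eq_abs, abs_of_nonneg (h0 i ω)]; exact h1 i ω)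
  have hint : ∀ i ∈ s, Integrable (X i) μ := fun i hi => (hL i hi).integrable (by norm_num)
  have hcov1 : ∀ i ∈ s, ∀ j ∈ s, cov[X i, X j; μ] ≤ 1 := by
    intro i hi j hj
    rw [covariance_eq_sub (hL i hi) (hL j hj)]
    have h2 : ∫ ω, (X i * X j) ω ∂μ ≤ 1 := by
      have := integral_mono ((hL i hi).integrable_mul (hL j hj)) (integrable_const (1 : ℝ))
        fun ω => mul_le_one₀ (h1 i ω) (h0 j ω) (h1 j ω)
      simpa using this
    have h3 : 0 ≤ (∫ ω, X i ω ∂μ) * ∫ ω, X j ω ∂μ :=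
      mul_nonneg (integral_nonneg (h0 i)) (integral_nonneg (h0 j))
    linarith
  have hcov0 : ∀ i ∈ s, ∀ j ∈ s, j ∉ Finset.Icc (i - 1) (i + 1) → cov[X i, X j; μ] = 0 := by
    intro i hi j hj hij
    rw [Finset.mem_Icc] at hij
    rcases lt_or_ge (i + 1) j with h | h
    · exact (hind i hi j hj h).covariance_eq_zero (hL i hi) (hL j hj)
    · exact (hind j hj i hi (by omega)).symm.covariance_eq_zero (hL i hi) (hL j hj)
  have hvar : variance (fun ω => ∑ i ∈ s, X i ω) μ ≤ 3 * s.card := by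
    rw [variance_fun_sum' hL]
    have h2 : ∀ i ∈ s, ∑ j ∈ s, cov[X i, X j; μ] ≤ 3 := by
      intro i hi
      calc ∑ j ∈ s, cov[X i, X j; μ]
          ≤ ∑ j ∈ s, if j ∈ Finset.Icc (i - 1) (i + 1) then (1 : ℝ) else 0 := by
            refine Finset.sum_le_sum fun j hj => ?_
            split_ifs with h
            · exact hcov1 i hi j hj
            · exact (hcov0 i hi j hj h).le
        _ = ((s.filter (· ∈ Finset.Icc (i - 1) (i + 1))).card : ℝ) := by
            rw [Finset.sum_boole]
        _ ≤ ((Finset.Icc (i - 1) (i + 1)).card : ℝ) := by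
            gcongr
            intro j hj
            exact (Finset.mem_filter.1 hj).2
        _ ≤ 3 := by
            rw [Nat.card_Icc]
            exact_mod_cast (by omega : i + 1 + 1 - (i - 1) ≤ 3)
    refine (Finset.sum_le_card_nsmul _ _ _ h2).trans (le_of_eq ?_)
    rw [nsmul_eq_mul, mul_comm]
  have hSL : MemLp (fun ω => ∑ i ∈ s, X i ω) 2 μ := memLp_finsetSum s hL
  have hmean : ∫ ω, ∑ i ∈ s, X i ω ∂μ ≤ p * s.card := by
    rw [integral_finsetSum s hint]
    refine (Finset.sum_le_card_nsmul _ _ _ hp).trans (le_of_eq ?_)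
    rw [nsmul_eq_mul, mul_comm]
  have hpos : 0 < η * s.card := by positivity
  refine (measure_mono ?_).trans ((meas_ge_le_variance_div_sq hSL hpos).trans
    (ENNReal.ofReal_le_ofReal ?_))
  · intro ω hω
    have h2 : (p + η) * s.card ≤ ∑ i ∈ s, X i ω := hω
    have h3 : η * s.card ≤ ∑ i ∈ s, X i ω - ∫ ω, ∑ i ∈ s, X i ω ∂μ := by linarith
    exact h3.trans (le_abs_self _)
  · rw [div_le_div_iff₀ (by positivity) (by positivity)]
    nlinarith [mul_le_mul_of_nonneg_right hvar (by positivity : 0 ≤ η ^ 2 * s.card)]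

/-- The density of `N(0, 2)` is at most `1 / √(4π)`, which bounds the probability that
`a + σ V` lies in an interval of length `2 m`, whatever the shift `a` is. -/
lemma measure_abs_add_mul_lt_le {V : Ω → ℝ} (hV : HasLaw V (gaussianReal 0 2) μ) {σ m : ℝ}
    (hσ : 0 < σ) (a : ℝ) :
    μ {ω | |a + σ * V ω| < m} ≤ ENNReal.ofReal (2 * m / σ / √(4 * Real.pi)) := by
  have h1 : MeasurableSet {x : ℝ | |a + σ * x| < m} := by
    apply measurableSet_lt <;> fun_prop
  rw [hV.measure_eq (p := fun x => |a + σ * x| < m) h1, gaussianReal_apply 0 two_ne_zero]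
  have h2 : {x : ℝ | |a + σ * x| < m} ⊆ Ioo ((-m - a) / σ) ((m - a) / σ) := by
    intro x hx
    obtain ⟨h3, h4⟩ := abs_lt.1 (show |a + σ * x| < m from hx)
    constructor
    · rw [div_lt_iff₀ hσ]; linarith
    · rw [lt_div_iff₀ hσ]; linarith
  have h3 : ∀ x, gaussianPDF 0 2 x ≤ ENNReal.ofReal (√(4 * Real.pi))⁻¹ := by
    intro x
    rw [gaussianPDF]
    refine ENNReal.ofReal_le_ofReal ?_
    rw [gaussianPDFReal]
    have h4 : (2 * Real.pi * ((2 : NNReal) : ℝ)) = 4 * Real.pi := by push_cast; ring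
    rw [h4]
    refine mul_le_of_le_one_right (by positivity) (Real.exp_le_one_iff.2 ?_)
    exact div_nonpos_of_nonpos_of_nonneg (neg_nonpos.2 (sq_nonneg _)) (by positivity)
  calc ∫⁻ x in {x : ℝ | |a + σ * x| < m}, gaussianPDF 0 2 x
      ≤ ∫⁻ x in Ioo ((-m - a) / σ) ((m - a) / σ), gaussianPDF 0 2 x := lintegral_mono_set h2
    _ ≤ ∫⁻ _ in Ioo ((-m - a) / σ) ((m - a) / σ), ENNReal.ofReal (√(4 * Real.pi))⁻¹ :=
        lintegral_mono fun x => h3 x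
    _ = ENNReal.ofReal (2 * m / σ / √(4 * Real.pi)) := by
        rw [lintegral_const, Measure.restrict_apply_univ, Real.volume_Ioo,
          ← ENNReal.ofReal_mul (by positivity)]
        congr 1
        field_simp
        ring

lemma IsGaussianNoise.hasLaw_sub {s : Finset ℕ} {W : ℕ → Ω → ℝ} (hW : IsGaussianNoise μ s W)
    {i j : ℕ} (hi : i ∈ s) (hj : j ∈ s) (hij : i ≠ j) :
    HasLaw (fun ω => W i ω - W j ω) (gaussianReal 0 2) μ := by
  have h1 := gaussianReal_neg (hW.law j hj)
  have h2 := gaussianReal_add_gaussianReal_of_indepFun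
    ((hW.indepFun hi hj hij).comp measurable_id measurable_neg)
    (hW.law i hi).map_eq h1.map_eq
  refine ⟨(hW.law i hi).aemeasurable.sub (hW.law j hj).aemeasurable, ?_⟩
  have e : (fun ω => W i ω - W j ω) = id ∘ W i + Neg.neg ∘ W j := by
    ext ω; simp [sub_eq_add_neg]
  rw [e]
  convert h2 using 2
  · simp
  · norm_num

variable {n : ℕ} {W : ℕ → Ω → ℝ}

lemma mem_Icc_of_mem {i : ℕ} (hi : i ∈ Finset.Icc 2 (n - 1)) :
    i ∈ Finset.Icc 1 n ∧ i - 1 ∈ Finset.Icc 1 n := by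
  simp only [Finset.mem_Icc] at hi ⊢
  omega

/-- With high probability the scale estimate is at least `0.9 σ`: each of the differences lies
below the corresponding bound with probability at most `0.49`, so that with high probability
fewer than half of them do. -/
lemma IsGaussianNoise.measure_scaleEst_lt [IsProbabilityMeasure μ]
    (hW : IsGaussianNoise μ (Finset.Icc 1 n) W)
    (hn : 3 ≤ n) {σ : ℝ} (hσ : 0 < σ) (a : ℕ → ℝ) :
    μ {ω | scaleEst n (fun i => a i + σ * W i ω) < 0.9 * σ} ≤
      ENNReal.ofReal (30000 / (n - 2)) := by
  classical
  set s := Finset.Icc 2 (n - 1) with hs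
  have hcard : (s.card : ℝ) = n - 2 := by
    rw [hs, Nat.card_Icc, Nat.sub_add_cancel (by omega), Nat.cast_sub (by omega), Nat.cast_two]
  have hne : s.Nonempty := Finset.nonempty_Icc.2 (by omega)
  set m := 0.9 * σ * √2 / 1.4826 with hm
  set b : ℕ → ℝ := fun i => a i - a (i - 1) with hb
  set φ : ℕ → ℝ × ℝ → ℝ := fun i x => if |b i + σ * (x.1 - x.2)| < m then 1 else 0 with hφ
  have hφm : ∀ i, Measurable (φ i) := fun i =>
    Measurable.ite (measurableSet_lt (by fun_prop) measurable_const) measurable_const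
      measurable_const
  set X : ℕ → Ω → ℝ := fun i ω => φ i (W i ω, W (i - 1) ω) with hX
  have haem : ∀ i ∈ Finset.Icc 1 n, AEMeasurable (W i) μ := fun i hi => (hW.law i hi).aemeasurable
  have hXm : ∀ i ∈ s, AEMeasurable (X i) μ := fun i hi =>
    (hφm i).comp_aemeasurable
      ((haem i (mem_Icc_of_mem hi).1).prodMk (haem (i - 1) (mem_Icc_of_mem hi).2))
  have hp : ∀ i ∈ s, ∫ ω, X i ω ∂μ ≤ 0.49 := by
    intro i hi
    obtain ⟨h1, h2⟩ := mem_Icc_of_mem hi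
    have hi2 : 2 ≤ i := (Finset.mem_Icc.1 hi).1
    have hV := hW.hasLaw_sub h1 h2 (by omega)
    have h3 : X i = {ω | |b i + σ * (W i ω - W (i - 1) ω)| < m}.indicator fun _ => 1 := by
      ext ω
      simp [hX, hφ, Set.indicator_apply]
    have h4 : NullMeasurableSet {ω | |b i + σ * (W i ω - W (i - 1) ω)| < m} μ :=
      nullMeasurableSet_lt ((hV.aemeasurable.const_mul σ).const_add (b i)).abs aemeasurable_const
    have h5 := measure_abs_add_mul_lt_le hV hσ (b i) (m := m)
    have h6 : 2 * m / σ / √(4 * Real.pi) ≤ 0.49 := by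
      have e : 2 * m / σ = 1.8 * √2 / 1.4826 := by
        rw [hm]; field_simp; norm_num
      rw [e, div_le_iff₀ (by positivity), div_le_iff₀ (by norm_num)]
      have h7 : √2 ≤ 1.415 := by
        rw [Real.sqrt_le_left (by norm_num)]; norm_num
      have h8 : 3.54 ≤ √(4 * Real.pi) := by
        refine Real.le_sqrt_of_sq_le ?_
        have := Real.pi_gt_d2
        norm_num at this ⊢
        linarith
      norm_num at h7 h8 ⊢
      linarith
    rw [h3, integral_indicator₀ h4, setIntegral_const, smul_eq_mul, mul_one]
    refine ENNReal.toReal_le_of_le_ofReal (by norm_num) (h5.trans ?_)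
    exact ENNReal.ofReal_le_ofReal h6
  have hind : ∀ i ∈ s, ∀ j ∈ s, i + 1 < j → IndepFun (X i) (X j) μ := by
    intro i hi j hj hij
    obtain ⟨h1, h2⟩ := mem_Icc_of_mem hi
    obtain ⟨h3, h4⟩ := mem_Icc_of_mem hj
    have h5 := hW.indep.indepFun_prodMk_prodMk₀ (fun i => haem i i.2) ⟨i, h1⟩ ⟨i - 1, h2⟩
      ⟨j, h3⟩ ⟨j - 1, h4⟩ (by simp; omega) (by simp; omega) (by simp; omega) (by simp; omega)
    exact h5.comp (hφm i) (hφm j)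
  have key := measure_le_sum_of_one_dependent hne (fun i hi => (hXm i hi).aestronglyMeasurable)
    (fun i ω => by simp only [hX, hφ]; split_ifs <;> norm_num)
    (fun i ω => by simp only [hX, hφ]; split_ifs <;> norm_num) hind hp
    (η := 0.01) (by norm_num)
  rw [hcard] at key
  refine (measure_mono ?_).trans (key.trans (ENNReal.ofReal_le_ofReal (le_of_eq ?_)))
  · intro ω hω
    have h1 : scaleEst n (fun i => a i + σ * W i ω) < 0.9 * σ := hω
    set S := s.val.map fun i => |a i + σ * W i ω - (a (i - 1) + σ * W (i - 1) ω)| with hS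
    have h2 : median S < m := by
      have h3 : 1.4826 / √2 * median S < 0.9 * σ := h1
      rw [hm, lt_div_iff₀ (by norm_num)]
      have h4 : 0 < √2 := by positivity
      rw [div_mul_eq_mul_div, div_lt_iff₀ h4] at h3
      linarith
    have h3 := card_le_two_mul_countP_of_median_lt h2
    rw [hS, Multiset.card_map, Multiset.countP_map] at h3
    have h5 : ∑ i ∈ s, X i ω = ((s.filter fun i =>
        |a i + σ * W i ω - (a (i - 1) + σ * W (i - 1) ω)| < m).card : ℝ) := by
      rw [← Finset.sum_boole]
      refine Finset.sum_congr rfl fun i _ => ?_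
      have e : b i + σ * (W i ω - W (i - 1) ω) =
        a i + σ * W i ω - (a (i - 1) + σ * W (i - 1) ω) := by simp only [hb]; ring
      simp only [hX, hφ, e]
    change (0.49 + 0.01) * ((n : ℝ) - 2) ≤ ∑ i ∈ s, X i ω
    rw [h5, ← hcard]
    have h6 : (s.card : ℝ) ≤ 2 * ((s.filter fun i =>
        |a i + σ * W i ω - (a (i - 1) + σ * W (i - 1) ω)| < m).card : ℝ) := by
      exact_mod_cast h3
    norm_num
    linarith
  · field_simp
    norm_num

/-- By Markov's inequality the scale estimate is bounded in probability. -/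
lemma IsGaussianNoise.measure_lt_scaleEst [IsProbabilityMeasure μ]
    (hW : IsGaussianNoise μ (Finset.Icc 1 n) W)
    (hn : 3 ≤ n) {σ F M : ℝ} (hM : 0 < M) {a : ℕ → ℝ}
    (ha : ∀ i ∈ Finset.Icc 1 n, |a i| ≤ F) :
    μ {ω | 1.4826 / √2 * M < scaleEst n (fun i => a i + σ * W i ω)} ≤
      ENNReal.ofReal (16 * (F ^ 2 + σ ^ 2) / M ^ 2) := by
  classical
  set s := Finset.Icc 2 (n - 1) with hs
  have hne : s.Nonempty := Finset.nonempty_Icc.2 (by omega)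
  have hcard : (0 : ℝ) < s.card := by exact_mod_cast hne.card_pos
  set X : Ω → ℝ := fun ω => ∑ i ∈ s,
    (8 * F ^ 2 + 4 * σ ^ 2 * (W i ω * W i ω + W (i - 1) ω * W (i - 1) ω)) with hX
  have hsq : ∀ i ∈ Finset.Icc 1 n, Integrable (fun ω => W i ω * W i ω) μ := fun i hi =>
    (hW.memLp hi).integrable_mul (hW.memLp hi)
  have hint : ∀ i ∈ s, Integrable (fun ω =>
      8 * F ^ 2 + 4 * σ ^ 2 * (W i ω * W i ω + W (i - 1) ω * W (i - 1) ω)) μ := fun i hi =>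
    (integrable_const _).add
      (((hsq i (mem_Icc_of_mem hi).1).add (hsq (i - 1) (mem_Icc_of_mem hi).2)).const_mul _)
  have hmean : ∫ ω, X ω ∂μ ≤ 8 * (F ^ 2 + σ ^ 2) * s.card := by
    rw [hX, integral_finsetSum s hint]
    have h1 : ∀ i ∈ s, ∫ ω, (8 * F ^ 2 +
        4 * σ ^ 2 * (W i ω * W i ω + W (i - 1) ω * W (i - 1) ω)) ∂μ ≤ 8 * (F ^ 2 + σ ^ 2) := by
      intro i hi
      obtain ⟨h2, h3⟩ := mem_Icc_of_mem hi
      have h4 : Integrable (fun ω => W i ω * W i ω + W (i - 1) ω * W (i - 1) ω) μ :=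
        (hsq i h2).add (hsq _ h3)
      rw [integral_add (integrable_const _) (h4.const_mul _), integral_const,
        integral_const_mul, integral_add (hsq i h2) (hsq _ h3), hW.integral_sq h2,
        hW.integral_sq h3]
      simp only [probReal_univ, smul_eq_mul]
      linarith
    refine (Finset.sum_le_card_nsmul _ _ _ h1).trans (le_of_eq ?_)
    rw [nsmul_eq_mul, mul_comm]
  have hpos : 0 < M ^ 2 * s.card / 2 := by positivity
  have key := measure_le_of_integral_le (integrable_finsetSum s hint)
    (fun ω => Finset.sum_nonneg fun i _ => add_nonneg (by positivity) (mul_nonneg (by positivity)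
      (add_nonneg (mul_self_nonneg _) (mul_self_nonneg _)))) hmean hpos
  refine (measure_mono ?_).trans (key.trans (ENNReal.ofReal_le_ofReal (le_of_eq ?_)))
  · intro ω hω
    set S := s.val.map fun i => |a i + σ * W i ω - (a (i - 1) + σ * W (i - 1) ω)| with hS
    have h2 : M < median S := by
      have h3 : 1.4826 / √2 * M < 1.4826 / √2 * median S := hω
      exact lt_of_mul_lt_mul_left h3 (by positivity)
    have h3 := card_le_two_mul_countP_of_lt_median h2
    rw [hS, Multiset.card_map, Multiset.countP_map] at h3
    set T := s.filter fun i => M < |a i + σ * W i ω - (a (i - 1) + σ * W (i - 1) ω)| with hT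
    have h6 : (s.card : ℝ) ≤ 2 * (T.card : ℝ) := by exact_mod_cast h3
    have h4 : ∀ i ∈ T, M ^ 2 ≤
        8 * F ^ 2 + 4 * σ ^ 2 * (W i ω * W i ω + W (i - 1) ω * W (i - 1) ω) := by
      intro i hi
      obtain ⟨hi1, hi2⟩ := Finset.mem_filter.1 hi
      have h7 := ha i (mem_Icc_of_mem hi1).1
      have h8 := ha (i - 1) (mem_Icc_of_mem hi1).2
      have h9 : M ^ 2 ≤ (a i + σ * W i ω - (a (i - 1) + σ * W (i - 1) ω)) ^ 2 := by
        rw [← sq_abs (a i + σ * W i ω - (a (i - 1) + σ * W (i - 1) ω))]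
        gcongr
      have h10 : a i ^ 2 ≤ F ^ 2 := sq_le_sq' (abs_le.1 h7).1 (abs_le.1 h7).2
      have h11 : a (i - 1) ^ 2 ≤ F ^ 2 := sq_le_sq' (abs_le.1 h8).1 (abs_le.1 h8).2
      nlinarith [sq_nonneg (a i + a (i - 1)), sq_nonneg (σ * W i ω + σ * W (i - 1) ω),
        sq_nonneg (a i - a (i - 1) - (σ * W i ω - σ * W (i - 1) ω))]
    have h5 := Finset.card_nsmul_le_sum _ _ _ h4
    rw [nsmul_eq_mul] at h5
    have h7 : ∑ i ∈ T, (8 * F ^ 2 + 4 * σ ^ 2 * (W i ω * W i ω + W (i - 1) ω * W (i - 1) ω)) ≤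
        X ω :=
      Finset.sum_le_sum_of_subset_of_nonneg (Finset.filter_subset _ _) fun i _ _ =>
        add_nonneg (by positivity) (mul_nonneg (by positivity)
          (add_nonneg (mul_self_nonneg _) (mul_self_nonneg _)))
    change M ^ 2 * s.card / 2 ≤ X ω
    nlinarith [sq_nonneg M]
  · field_simp
    ring

end Scale

/-! ### Consequences of the stochastic bounds -/

section GoodEvent

variable {n : ℕ} {lam σ x : ℝ} {w : ℕ → ℝ} {f : ℝ → ℝ}

/-- The spline for the data `f(tᵢ) + σ wᵢ` is the sum of the splines for the two parts. The
residuals of the first part are small in the Euclidean norm, by comparison with `f`; those of the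
second part are linear forms in the noise. -/
lemma equalSpline_mem_region (hf : MemH2 f) (hσ : 0 ≤ σ) (hlam : 0 < lam) {y : ℕ → ℝ}
    (hy : ∀ i, y i = f (design n i) + σ * w i)
    (hw : ∀ k m, |∑ j ∈ Finset.Icc 1 n, residCoeff n lam (block n k m) j * w j| ≤
      x * √((block n k m).card : ℝ)) (hx : 0 ≤ x)
    (hthr : σ * x + √(roughness f / lam) ≤ threshold n y) :
    equalSpline n y lam ∈ region n y ∧ roughness (equalSpline n y lam) ≤
      2 * roughness f + 2 * σ ^ 2 * roughness (fun t =>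
        ∑ j ∈ Finset.Icc 1 n, w j * basisSpline n lam j t) := by
  set g := equalSpline n y lam
  set gf := weightedSpline n (fun _ => lam) (fun i => f (design n i))
  set gw : ℝ → ℝ := fun t => ∑ j ∈ Finset.Icc 1 n, w j * basisSpline n lam j t with hgw
  have hsf : IsEqualSpline n lam (fun i => f (design n i)) gf :=
    isWeightedSpline_weightedSpline n (fun _ => hlam.le) _
  have hsw : IsEqualSpline n lam w gw := isEqualSpline_sum_basisSpline hlam.le w
  have hs : IsEqualSpline n lam y (fun t => gf t + σ * gw t) :=
    (hsf.add_mul hsw hlam.le σ).congr fun i _ => (hy i).symm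
  have hsg : IsEqualSpline n lam y g := equalSpline_of_pos n y hlam
  have hcmp := hsf.le hf
  simp only [sub_self, ne_eq, OfNat.ofNat_ne_zero, not_false_eq_true, zero_pow,
    Finset.sum_const_zero, mul_zero, zero_add] at hcmp
  have hQ0 : 0 ≤ ∑ i ∈ Finset.Icc 1 n, (f (design n i) - gf (design n i)) ^ 2 :=
    Finset.sum_nonneg fun _ _ => sq_nonneg _
  constructor
  · intro k m
    set I := block n k m with hI
    have hsub : I ⊆ Finset.Icc 1 n := block_subset n k m
    have h1 : resid n y I g = (∑ i ∈ I, (f (design n i) - gf (design n i))) / √(I.card : ℝ) +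
        σ * ((∑ j ∈ Finset.Icc 1 n, residCoeff n lam I j * w j) / √(I.card : ℝ)) := by
      rw [← sum_resid_eq hsub, ← mul_div_assoc, ← add_div, resid, Finset.mul_sum,
        ← Finset.sum_add_distrib]
      congr 1
      refine Finset.sum_congr rfl fun i hi => ?_
      rw [hsg.eq_design hs hlam (hsub hi), hy]
      simp only [hgw]
      ring
    have h2 : |(∑ i ∈ I, (f (design n i) - gf (design n i))) / √(I.card : ℝ)| ≤
        √(roughness f / lam) := by
      refine (abs_sum_div_sqrt_card_le hsub _).trans (Real.sqrt_le_sqrt ?_)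
      rw [le_div_iff₀ hlam]
      linarith [roughness_nonneg gf]
    have h3 : |(∑ j ∈ Finset.Icc 1 n, residCoeff n lam I j * w j) / √(I.card : ℝ)| ≤ x := by
      rw [abs_div, abs_of_nonneg (Real.sqrt_nonneg _)]
      exact div_le_of_le_mul₀ (Real.sqrt_nonneg _) hx (hw k m)
    rw [h1]
    refine (abs_add_le _ _).trans (le_trans ?_ hthr)
    rw [abs_mul, abs_of_nonneg hσ, add_comm]
    gcongr
  · have h1 : roughness gf ≤ roughness f := by nlinarith [mul_nonneg hlam.le hQ0]
    have h2 := roughness_sub_le hsf.1 (hsw.1.const_mul (-σ))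
    rw [roughness_const_mul hsw.1] at h2
    have h3 : (fun t => gf t - -σ * gw t) = fun t => gf t + σ * gw t := by ext t; ring
    rw [h3] at h2
    rw [hsg.roughness_eq hs hlam]
    linarith

/-- Functions in the region differ from `f` by a function with small sums over blocks. -/
lemma abs_sub_le_of_mem_region (hf : MemH2 f) (hσ : 0 ≤ σ) {y : ℕ → ℝ}
    (hy : ∀ i, y i = f (design n i) + σ * w i) (hn : 0 < n)
    (hw : ∀ k m, |∑ i ∈ block n k m, w i| ≤ x * √((block n k m).card : ℝ))
    {g : ℝ → ℝ} (hg : MemH2 g) (hgr : g ∈ region n y) {T R : ℝ} (hT : threshold n y ≤ T)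
    (hR : roughness g ≤ R) {k : ℕ} {t : ℝ}
    (ht0 : 2 * 2 ^ k ≤ n * t) (ht1 : n * t + 2 * 2 ^ k ≤ n) :
    |g t - f t| ≤ (T + σ * x) / √(2 ^ k : ℝ) +
      (2 * 2 ^ k / n) * √(2 * 2 ^ k / n : ℝ) * √(2 * R + 2 * roughness f) := by
  have h1 := abs_le_of_block_sums (hg.sub hf) (D := T + σ * x) (k := k) (t := t) hn
    (fun m hm => by
      have hcard : ((block n k m).card : ℝ) = 2 ^ k := by
        rw [card_block hm]; push_cast; rfl
      have h2 := hgr k m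
      have h3 := hw k m
      rw [hcard] at h3
      rw [resid, hcard, abs_div, abs_of_nonneg (Real.sqrt_nonneg _),
        div_le_iff₀ (by positivity)] at h2
      have h4 : ∑ i ∈ block n k m, (g (design n i) - f (design n i)) =
          σ * ∑ i ∈ block n k m, w i - ∑ i ∈ block n k m, (y i - g (design n i)) := by
        rw [Finset.mul_sum, ← Finset.sum_sub_distrib]
        exact Finset.sum_congr rfl fun i _ => by rw [hy]; ring
      rw [h4]
      calc _ ≤ |σ * ∑ i ∈ block n k m, w i| + |∑ i ∈ block n k m, (y i - g (design n i))| :=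
            abs_sub _ _
        _ ≤ σ * (x * √(2 ^ k)) + T * √(2 ^ k) := by
            rw [abs_mul, abs_of_nonneg hσ]
            gcongr
            exact h2.trans (by gcongr)
        _ = _ := by ring) ht0 ht1
  refine h1.trans ?_
  have h5 : roughness (fun t => g t - f t) ≤ 2 * R + 2 * roughness f :=
    (roughness_sub_le hg hf).trans (by linarith)
  gcongr

/-- The error bound for the modified estimate on the event that the noise is well behaved. -/
lemma abs_modifiedEstimate_sub_le (hf : MemH2 f) (hσ : 0 ≤ σ) (hlam : 0 < lam) {y : ℕ → ℝ}
    (hy : ∀ i, y i = f (design n i) + σ * w i) (hn : 0 < n) (hx : 0 ≤ x)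
    (hw : ∀ k m, |∑ i ∈ block n k m, w i| ≤ x * √((block n k m).card : ℝ))
    (hw' : ∀ k m, |∑ j ∈ Finset.Icc 1 n, residCoeff n lam (block n k m) j * w j| ≤
      x * √((block n k m).card : ℝ))
    {T V : ℝ} (hV : roughness (fun t => ∑ j ∈ Finset.Icc 1 n, w j * basisSpline n lam j t) ≤ V)
    (hthr : σ * x + √(roughness f / lam) ≤ threshold n y) (hT : threshold n y ≤ T)
    {q l : ℝ} (hq : 0 ≤ q) (hl : 0 ≤ l) {k : ℕ} {t : ℝ}
    (ht0 : 2 * 2 ^ k ≤ n * t) (ht1 : n * t + 2 * 2 ^ k ≤ n) :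
    |modifiedEstimate q l n y t - f t| ≤ (T + σ * x) / √(2 ^ k : ℝ) +
      (2 * 2 ^ k / n) * √(2 * 2 ^ k / n : ℝ) * √(6 * roughness f + 4 * σ ^ 2 * V) := by
  obtain ⟨hmem, hrough⟩ := equalSpline_mem_region hf hσ hlam hy hw' hx hthr
  obtain ⟨hreg, hH2, hle⟩ := modifiedEstimate_spec hq hl hlam.le hmem
  have hR : roughness (modifiedEstimate q l n y) ≤ 2 * roughness f + 2 * σ ^ 2 * V :=
    (hle.trans hrough).trans (by gcongr)
  have h1 := abs_sub_le_of_mem_region hf hσ hy hn hw hH2 hreg hT hR ht0 ht1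
  have h2 : 2 * (2 * roughness f + 2 * σ ^ 2 * V) + 2 * roughness f =
      6 * roughness f + 4 * σ ^ 2 * V := by ring
  rwa [h2] at h1

/-- Union bound over all dyadic blocks. -/
lemma IsGaussianNoise.measure_block_le {Ω : Type*} [MeasurableSpace Ω] {μ : Measure Ω}
    [IsProbabilityMeasure μ] {W : ℕ → Ω → ℝ} (hW : IsGaussianNoise μ (Finset.Icc 1 n) W)
    (hn : 0 < n) {c : Finset ℕ → ℕ → ℝ}
    (hc : ∀ I ⊆ Finset.Icc 1 n, ∑ j ∈ Finset.Icc 1 n, c I j ^ 2 ≤ I.card) (hx : 0 ≤ x) :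
    μ {ω | ¬ ∀ k m, |∑ j ∈ Finset.Icc 1 n, c (block n k m) j * W j ω| ≤
      x * √((block n k m).card : ℝ)} ≤
      ENNReal.ofReal ((Nat.clog 2 n + 1) * n * (2 * Real.exp (-x ^ 2 / 2))) := by
  set T := Finset.range (Nat.clog 2 n + 1) ×ˢ Finset.range n with hT
  have hcard : (T.card : ℝ) = (Nat.clog 2 n + 1) * n := by
    rw [hT, Finset.card_product, Finset.card_range, Finset.card_range]; push_cast; rfl
  rw [← hcard]
  refine (measure_mono fun ω hω => ?_).trans (hW.measure_exists_lt_abs_sum_le T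
    (a := fun p j => c (block n p.1 p.2) j / √((block n p.1 p.2).card : ℝ)) (fun p _ => ?_) hx)
  · have hω' : ¬ ∀ k m, |∑ j ∈ Finset.Icc 1 n, c (block n k m) j * W j ω| ≤
      x * √((block n k m).card : ℝ) := hω
    push Not at hω'
    obtain ⟨k, m, h⟩ := hω'
    have hpos : 0 < √((block n k m).card : ℝ) := by
      refine (Real.sqrt_nonneg _).lt_of_ne fun h0 => ?_
      have h1 : ((block n k m).card : ℝ) = 0 := (Real.sqrt_eq_zero (by positivity)).1 h0.symm
      have h2 := hc _ (block_subset n k m)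
      rw [h1] at h2
      have h3 : ∀ j ∈ Finset.Icc 1 n, c (block n k m) j = 0 := fun j hj => by
        have := (Finset.single_le_sum (f := fun j => c (block n k m) j ^ 2)
          (fun _ _ => sq_nonneg _) hj).trans h2
        exact pow_eq_zero_iff two_ne_zero |>.1 (le_antisymm this (sq_nonneg _))
      rw [← h0, mul_zero, Finset.sum_eq_zero fun j hj => by rw [h3 j hj, zero_mul], abs_zero] at h
      exact lt_irrefl _ h
    rcases block_eq_empty_or hn k m with he | ⟨k', hk', m', hm', he⟩
    · rw [he] at hpos
      simp at hpos
    · refine ⟨(k', m'), ?_, ?_⟩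
      · simp only [hT, Finset.mem_product, Finset.mem_range]
        omega
      · rw [he] at h hpos
        have h1 : ∑ j ∈ Finset.Icc 1 n, c (block n k' m') j / √((block n k' m').card : ℝ) * W j ω =
            (∑ j ∈ Finset.Icc 1 n, c (block n k' m') j * W j ω) /
              √((block n k' m').card : ℝ) := by
          rw [Finset.sum_div]
          exact Finset.sum_congr rfl fun j _ => by ring
        rw [h1, abs_div, abs_of_pos hpos, lt_div_iff₀ hpos]
        exact h
  · simp only [div_pow]
    rw [← Finset.sum_div, Real.sq_sqrt (by positivity)]
    exact div_le_one_of_le₀ (hc _ (block_subset n _ _)) (by positivity)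

end GoodEvent

/-! ### Orders of magnitude -/

section Rates

/-- The block length `2 ^ k` balances the two error terms: if `q` is of the order of `2 ^ k`, the
stochastic error is `(L / q)^{1/2}` and the smoothness error is `((q / n)³ ρ)^{1/2}`. -/
lemma error_le {n K q L ρ r A B : ℝ} (hn : 0 < n) (hK : 0 < K) (hKq : K ≤ q) (hqK : q ≤ 2 * K)
    (hr : 0 ≤ r) (hL : L = q * r ^ 2) (hρ : q ^ 3 * ρ = n ^ 3 * r ^ 2)
    (hA : 0 ≤ A) (hB : 0 ≤ B) (hρ0 : 0 ≤ ρ) :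
    A * √L / √K + (2 * K / n) * √(2 * K / n) * √(B * ρ) ≤ (2 * A + 3 * √B) * r := by
  have hL' : √L ≤ 2 * r * √K := by
    rw [hL]
    refine Real.sqrt_le_iff.2 ⟨by positivity, ?_⟩
    rw [mul_pow, Real.sq_sqrt hK.le]
    nlinarith [sq_nonneg r, mul_le_mul_of_nonneg_right hqK (sq_nonneg r),
      mul_nonneg hK.le (sq_nonneg r)]
  have h1 : A * √L / √K ≤ 2 * A * r := by
    rw [div_le_iff₀ (by positivity)]
    nlinarith [mul_le_mul_of_nonneg_left hL' hA]
  have h2 : (2 * K / n) * √(2 * K / n) * √(B * ρ) ≤ 3 * √B * r := by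
    have h3 : 0 ≤ 2 * K / n := by positivity
    have h4 : (2 * K / n) * √(2 * K / n) * √ρ ≤ 3 * r := by
      refine (pow_le_pow_iff_left₀ (by positivity) (by positivity) two_ne_zero).1 ?_
      rw [mul_pow, mul_pow, Real.sq_sqrt h3, Real.sq_sqrt hρ0]
      have h5 : K ^ 3 * ρ ≤ n ^ 3 * r ^ 2 := by
        rw [← hρ]
        gcongr
      have h6 : (2 * K / n) ^ 2 * (2 * K / n) * ρ = 8 * (K ^ 3 * ρ) / n ^ 3 := by
        field_simp; ring
      rw [h6, div_le_iff₀ (by positivity)]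
      nlinarith [mul_nonneg (pow_nonneg hn.le 3) (sq_nonneg r)]
    rw [Real.sqrt_mul hB]
    nlinarith [mul_le_mul_of_nonneg_left h4 (Real.sqrt_nonneg B)]
  linarith

/-- `∑ R(gᵢ)` is of order `n^{1/4} (log n)^{-5/4}` for the weight `c / log n`. -/
lemma sum_roughness_basisSpline_le {n N : ℕ} {c L Q : ℝ} (hL : 0 < L) (hc : 0 < c)
    (hQ4 : 5 * c * Q ^ 4 = n ^ 3 * L) (hN : N = ⌊Q⌋₊) (hQ1 : 1 ≤ Q) (hQn : 4 * Q ≤ n) :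
    ∑ i ∈ Finset.Icc 1 n, roughness (basisSpline n (c / L) i) ≤ 30 * c * n / (L * Q) := by
  have hQ0 : 0 < Q := by linarith
  have hNQ : (N : ℝ) ≤ Q := hN ▸ Nat.floor_le hQ0.le
  have hN1 : 1 ≤ N := hN ▸ (Nat.one_le_floor_iff Q).2 hQ1
  have hQN : Q ≤ 2 * N := by
    have h1 := Nat.lt_floor_add_one Q
    rw [← hN] at h1
    have : (1 : ℝ) ≤ N := by exact_mod_cast hN1
    linarith
  have hN0 : (0 : ℝ) < N := by linarith
  have hNn : 4 * N ≤ n := by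
    have : (4 : ℝ) * N ≤ n := by linarith
    exact_mod_cast this
  have hlam : 5 * (N : ℝ) ^ 4 * (c / L) ≤ (n : ℝ) ^ 3 := by
    have h1 : (N : ℝ) ^ 4 ≤ Q ^ 4 := by gcongr
    rw [← mul_div_assoc, div_le_iff₀ hL, ← hQ4]
    nlinarith [mul_le_mul_of_nonneg_left h1 hc.le]
  have h1 : ∀ i ∈ Finset.Icc 1 n, roughness (basisSpline n (c / L) i) ≤ c / L * (30 / Q) := by
    intro i hi
    refine (roughness_basisSpline_le (div_pos hc hL) hN1 hNn hlam hi).trans ?_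
    have h2 : 15 / (N : ℝ) ≤ 30 / Q := by
      rw [div_le_div_iff₀ hN0 hQ0]
      linarith
    gcongr
  refine (Finset.sum_le_card_nsmul _ _ _ h1).trans (le_of_eq ?_)
  rw [Nat.card_Icc, Nat.add_sub_cancel, nsmul_eq_mul]
  field_simp

end Rates

section Asymptotics

lemma mul_sq_rate_eq {n L : ℝ} (hn : 0 < n) (hL : 0 < L) :
    L = n ^ (11 / 16 : ℝ) * L ^ (9 / 16 : ℝ) *
      (L ^ (7 / 32 : ℝ) * n ^ (-(11 / 32) : ℝ)) ^ 2 := by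
  have e1 : (n ^ (-(11 / 32) : ℝ)) ^ 2 = n ^ (-(11 / 16) : ℝ) := by
    rw [← Real.rpow_natCast, ← Real.rpow_mul hn.le]; norm_num
  have e2 : (L ^ (7 / 32 : ℝ)) ^ 2 = L ^ (7 / 16 : ℝ) := by
    rw [← Real.rpow_natCast, ← Real.rpow_mul hL.le]; norm_num
  have e3 : n ^ (11 / 16 : ℝ) * n ^ (-(11 / 16) : ℝ) = 1 := by
    rw [← Real.rpow_add hn]; norm_num
  have e4 : L ^ (9 / 16 : ℝ) * L ^ (7 / 16 : ℝ) = L := by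
    rw [← Real.rpow_add hL]; norm_num
  rw [mul_pow, e1, e2]
  calc L = (n ^ (11 / 16 : ℝ) * n ^ (-(11 / 16) : ℝ)) *
        (L ^ (9 / 16 : ℝ) * L ^ (7 / 16 : ℝ)) := by rw [e3, e4, one_mul]
    _ = _ := by ring

lemma cube_mul_eq {n L : ℝ} (hn : 0 < n) (hL : 0 < L) :
    (n ^ (11 / 16 : ℝ) * L ^ (9 / 16 : ℝ)) ^ 3 * (n ^ (1 / 4 : ℝ) * L ^ (-(5 / 4) : ℝ)) =
      n ^ 3 * (L ^ (7 / 32 : ℝ) * n ^ (-(11 / 32) : ℝ)) ^ 2 := by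
  have e1 : (n ^ (-(11 / 32) : ℝ)) ^ 2 = n ^ (-(11 / 16) : ℝ) := by
    rw [← Real.rpow_natCast, ← Real.rpow_mul hn.le]; norm_num
  have e2 : (L ^ (7 / 32 : ℝ)) ^ 2 = L ^ (7 / 16 : ℝ) := by
    rw [← Real.rpow_natCast, ← Real.rpow_mul hL.le]; norm_num
  have e3 : (n ^ (11 / 16 : ℝ)) ^ 3 = n ^ (33 / 16 : ℝ) := by
    rw [← Real.rpow_natCast, ← Real.rpow_mul hn.le]; norm_num
  have e4 : (L ^ (9 / 16 : ℝ)) ^ 3 = L ^ (27 / 16 : ℝ) := by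
    rw [← Real.rpow_natCast, ← Real.rpow_mul hL.le]; norm_num
  have e5 : n ^ (33 / 16 : ℝ) * n ^ (1 / 4 : ℝ) = n ^ 3 * n ^ (-(11 / 16) : ℝ) := by
    rw [← Real.rpow_natCast n 3, ← Real.rpow_add hn, ← Real.rpow_add hn]; norm_num
  have e6 : L ^ (27 / 16 : ℝ) * L ^ (-(5 / 4) : ℝ) = L ^ (7 / 16 : ℝ) := by
    rw [← Real.rpow_add hL]; norm_num
  rw [mul_pow, mul_pow, e1, e2, e3, e4]
  calc _ = (n ^ (33 / 16 : ℝ) * n ^ (1 / 4 : ℝ)) *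
        (L ^ (27 / 16 : ℝ) * L ^ (-(5 / 4) : ℝ)) := by ring
    _ = _ := by rw [e5, e6]; ring

lemma block_length_mul_eq {n L : ℝ} (hn : 0 < n) (hL : 0 < L) :
    n ^ (5 / 16 : ℝ) * L ^ (-(9 / 16) : ℝ) * (n ^ (11 / 16 : ℝ) * L ^ (9 / 16 : ℝ)) = n := by
  have e1 : n ^ (5 / 16 : ℝ) * n ^ (11 / 16 : ℝ) = n := by
    rw [← Real.rpow_add hn]; norm_num
  have e2 : L ^ (-(9 / 16) : ℝ) * L ^ (9 / 16 : ℝ) = 1 := by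
    rw [← Real.rpow_add hL]; norm_num
  calc _ = (n ^ (5 / 16 : ℝ) * n ^ (11 / 16 : ℝ)) * (L ^ (-(9 / 16) : ℝ) * L ^ (9 / 16 : ℝ)) := by
        ring
    _ = n := by rw [e1, e2, mul_one]

/-- A power of two between half a given number and the number itself. -/
lemma exists_two_pow {q : ℝ} (hq : 1 ≤ q) : ∃ k : ℕ, (2 : ℝ) ^ k ≤ q ∧ q ≤ 2 * 2 ^ k := by
  obtain ⟨k, hk1, hk2⟩ := exists_nat_pow_near hq one_lt_two
  exact ⟨k, hk1, by rw [pow_succ'] at hk2; exact hk2.le⟩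

lemma eventually_log_rpow_le (p : ℝ) {s c : ℝ} (hs : 0 < s) (hc : 0 < c) :
    ∀ᶠ n : ℕ in atTop, Real.log n ^ p ≤ c * (n : ℝ) ^ s := by
  have h1 := ((isLittleO_log_rpow_rpow_atTop p hs).bound hc).natCast_atTop
  filter_upwards [h1] with n h
  rw [Real.norm_eq_abs, Real.norm_eq_abs, abs_of_nonneg (a := (n : ℝ) ^ s) (by positivity)] at h
  exact (le_abs_self _).trans h

/-- The right-hand side of the union bound over all blocks tends to zero, as the Gaussian
tail at `1.5 (log n)^{1/2}` is of order `n^{-9/8}`. -/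
lemma eventually_union_bound_le {ε : ℝ} (hε : 0 < ε) : ∀ᶠ n : ℕ in atTop,
    (Nat.clog 2 n + 1 : ℝ) * n * (2 * Real.exp (-(1.5 * √(Real.log n)) ^ 2 / 2)) ≤ ε := by
  filter_upwards [eventually_log_rpow_le 1 (s := 1 / 8) (by norm_num)
    (by positivity : 0 < ε / 8), eventually_ge_atTop 3] with n h1 hn
  have hn' : (3 : ℝ) ≤ n := by exact_mod_cast hn
  have hn0 : (0 : ℝ) < n := by linarith
  set L := Real.log n with hLdef
  have hL : 1 ≤ L := by
    rw [hLdef, Real.le_log_iff_exp_le hn0]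
    exact Real.exp_one_lt_d9.le.trans (by linarith)
  rw [Real.rpow_one] at h1
  have hclog : (Nat.clog 2 n : ℝ) + 1 ≤ 4 * L := by
    have h2 : (Nat.clog 2 n : ℝ) < Real.logb 2 n + 1 := by
      rw [← Real.natCeil_logb_natCast]
      push_cast
      exact Nat.ceil_lt_add_one (Real.logb_nonneg one_lt_two (by linarith))
    have h3 : Real.logb 2 n ≤ 2 * L := by
      rw [Real.logb, div_le_iff₀ (Real.log_pos one_lt_two)]
      nlinarith [Real.log_two_gt_d9]
    linarith
  have hexp : Real.exp (-(1.5 * √L) ^ 2 / 2) = (n : ℝ) ^ (-(9 / 8) : ℝ) := by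
    rw [mul_pow, Real.sq_sqrt (by linarith), Real.rpow_def_of_pos hn0]
    congr 1
    rw [← hLdef]
    ring
  have hmul : n * (n : ℝ) ^ (-(9 / 8) : ℝ) * (n : ℝ) ^ (1 / 8 : ℝ) = 1 := by
    nth_rewrite 1 [← Real.rpow_one (n : ℝ)]
    rw [← Real.rpow_add hn0, ← Real.rpow_add hn0]
    norm_num
  rw [hexp]
  set P := (n : ℝ) ^ (-(9 / 8) : ℝ) with hP
  have hP0 : 0 ≤ P := by positivity
  calc (Nat.clog 2 n + 1 : ℝ) * n * (2 * P)
      ≤ 4 * (ε / 8 * (n : ℝ) ^ (1 / 8 : ℝ)) * n * (2 * P) := by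
        gcongr
        linarith
    _ = ε * (n * P * (n : ℝ) ^ (1 / 8 : ℝ)) := by ring
    _ = ε := by rw [hmul, mul_one]

/-- With the weight `c / log n` the mean roughness of the spline for the noise is of order
`n^{1/4} (log n)^{-5/4}`. -/
lemma exists_sum_roughness_le {c : ℝ} (hc : 0 < c) : ∃ C : ℝ, 0 < C ∧ ∀ᶠ n : ℕ in atTop,
    ∑ i ∈ Finset.Icc 1 n, roughness (basisSpline n (c / Real.log n) i) ≤
      C * ((n : ℝ) ^ (1 / 4 : ℝ) * Real.log n ^ (-(5 / 4) : ℝ)) := by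
  set κ := (5 * c) ^ (-(1 / 4) : ℝ) with hκ
  have hκ0 : 0 < κ := by positivity
  have hκ4 : 5 * c * κ ^ 4 = 1 := by
    have h1 : κ ^ 4 = (5 * c) ^ (-1 : ℝ) := by
      rw [hκ, ← Real.rpow_natCast, ← Real.rpow_mul (by positivity)]; norm_num
    rw [h1, Real.rpow_neg_one, mul_inv_cancel₀ (by positivity)]
  refine ⟨30 * c / κ, by positivity, ?_⟩
  have hlarge : ∀ᶠ n : ℕ in atTop, 1 / κ ≤ (n : ℝ) ^ (3 / 4 : ℝ) :=
    ((tendsto_rpow_atTop (by norm_num : (0 : ℝ) < 3 / 4)).comp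
      tendsto_natCast_atTop_atTop).eventually_ge_atTop _
  filter_upwards [hlarge, eventually_log_rpow_le (1 / 4) (s := 1 / 4) (by norm_num)
    (by positivity : 0 < 1 / (4 * κ)), eventually_ge_atTop 3] with n h1 h2 hn
  have hn' : (3 : ℝ) ≤ n := by exact_mod_cast hn
  have hn0 : (0 : ℝ) < n := by linarith
  set L := Real.log n with hLdef
  have hL : 1 ≤ L := by
    rw [hLdef, Real.le_log_iff_exp_le hn0]
    exact Real.exp_one_lt_d9.le.trans (by linarith)
  have hL0 : 0 < L := by linarith
  have e1 : (n : ℝ) ^ (3 / 4 : ℝ) * (n : ℝ) ^ (1 / 4 : ℝ) = n := by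
    rw [← Real.rpow_add hn0]; norm_num
  have e2 : L ^ (-(5 / 4) : ℝ) * (L * L ^ (1 / 4 : ℝ)) = 1 := by
    nth_rewrite 2 [← Real.rpow_one L]
    rw [← Real.rpow_add hL0, ← Real.rpow_add hL0]; norm_num
  have e3 : ((n : ℝ) ^ (3 / 4 : ℝ)) ^ 4 = (n : ℝ) ^ 3 := by
    rw [← Real.rpow_natCast, ← Real.rpow_mul hn0.le, ← Real.rpow_natCast]; norm_num
  have e4 : (L ^ (1 / 4 : ℝ)) ^ 4 = L := by
    rw [← Real.rpow_natCast, ← Real.rpow_mul hL0.le]; norm_num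
  set Q := κ * (n : ℝ) ^ (3 / 4 : ℝ) * L ^ (1 / 4 : ℝ) with hQ
  have hQ1 : 1 ≤ Q := by
    have h3 : 1 ≤ L ^ (1 / 4 : ℝ) := Real.one_le_rpow hL (by norm_num)
    have h4 : 1 ≤ κ * (n : ℝ) ^ (3 / 4 : ℝ) := by
      rw [div_le_iff₀ hκ0] at h1
      linarith
    exact one_le_mul_of_one_le_of_one_le h4 h3
  have hQn : 4 * Q ≤ n := by
    calc 4 * Q = 4 * κ * (n : ℝ) ^ (3 / 4 : ℝ) * L ^ (1 / 4 : ℝ) := by rw [hQ]; ring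
      _ ≤ 4 * κ * (n : ℝ) ^ (3 / 4 : ℝ) * (1 / (4 * κ) * (n : ℝ) ^ (1 / 4 : ℝ)) := by gcongr
      _ = (n : ℝ) ^ (3 / 4 : ℝ) * (n : ℝ) ^ (1 / 4 : ℝ) := by field_simp
      _ = n := e1
  have hQ4 : 5 * c * Q ^ 4 = n ^ 3 * L := by
    rw [hQ, mul_pow, mul_pow, e3, e4]
    calc _ = (5 * c * κ ^ 4) * (n ^ 3 * L) := by ring
      _ = _ := by rw [hκ4, one_mul]
  refine (sum_roughness_basisSpline_le hL0 hc hQ4 rfl hQ1 hQn).trans (le_of_eq ?_)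
  rw [div_eq_iff (by positivity)]
  calc 30 * c * (n : ℝ) = 30 * c * ((n : ℝ) ^ (3 / 4 : ℝ) * (n : ℝ) ^ (1 / 4 : ℝ)) *
        (L ^ (-(5 / 4) : ℝ) * (L * L ^ (1 / 4 : ℝ))) := by rw [e1, e2, mul_one]
    _ = _ := by
        rw [hQ]
        field_simp

end Asymptotics

/-! ### The rate of convergence -/

section Rate

/-- The threshold leaves room for the bias once the scale estimate is at least `0.9 σ`, because
`0.9 √3 > 1.5 + 0.05`. -/
lemma bias_add_le_threshold {n : ℕ} {y : ℕ → ℝ} {σ R : ℝ} (hσ : 0 < σ) (hR : 0 ≤ R)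
    (hL : 0 < Real.log n) (hs : 0.9 * σ ≤ scaleEst n y) :
    σ * (1.5 * √(Real.log n)) + √(R / (400 * (R + 1) / σ ^ 2 / Real.log n)) ≤
      threshold n y := by
  set L := Real.log n with hLdef
  have h1 : √(R / (400 * (R + 1) / σ ^ 2 / L)) ≤ 0.05 * σ * √L := by
    refine Real.sqrt_le_iff.2 ⟨by positivity, ?_⟩
    rw [mul_pow, Real.sq_sqrt hL.le]
    have e : R / (400 * (R + 1) / σ ^ 2 / L) = R / (R + 1) * (σ ^ 2 * L / 400) := by
      field_simp
    rw [e]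
    have h2 : R / (R + 1) ≤ 1 := div_le_one_of_le₀ (by linarith) (by linarith)
    have h3 : 0 ≤ σ ^ 2 * L / 400 := by positivity
    nlinarith
  have h4 : 1.73 ≤ √3 := by
    refine Real.le_sqrt_of_sq_le ?_
    norm_num
  have h5 : 1.73 * √L ≤ √(3 * L) := by
    rw [Real.sqrt_mul (by norm_num)]
    gcongr
  have h6 : 0.9 * σ * (1.73 * √L) ≤ threshold n y := by
    rw [threshold]
    have : 0 ≤ 0.9 * σ := by positivity
    exact mul_le_mul hs h5 (by positivity) (this.trans hs)
  have h7 : 0 ≤ σ * √L := by positivity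
  norm_num at h1 h6 ⊢
  linarith

end Rate

end WSpline

end

open WSpline in
theorem mainTheorem2
    {Ω : Type*} [MeasurableSpace Ω] (μ : Measure Ω) [IsProbabilityMeasure μ]
    (f : ℝ → ℝ) (hf : WSpline.MemH2 f)
    (σ : ℝ) (hσ : 0 < σ)
    (Z : ℕ → ℕ → Ω → ℝ)
    (hZ_law : ∀ n : ℕ, ∀ i ∈ Finset.Icc 1 n, HasLaw (Z n i) (gaussianReal 0 1) μ)
    (hZ_indep : ∀ n : ℕ, iIndepFun (fun i : Finset.Icc 1 n => Z n i) μ)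
    (q : ℝ) (hq : 1 < q)
    (lam₁ : ℕ → (ℕ → ℝ) → ℝ) (hlam₁ : ∀ n y, 0 < lam₁ n y)
    (δ : ℕ → ℝ)
    (hδ : Tendsto
      (fun n : ℕ => δ n * (n : ℝ) ^ (5 / 16 : ℝ) * (Real.log n) ^ (-(9 / 16) : ℝ)) atTop atTop)
    (Y : ℕ → Ω → ℕ → ℝ)
    (hY : ∀ n ω i, Y n ω i = f (WSpline.design n i) + σ * Z n i ω) :
    WSpline.IsBigOP μ
      (fun n ω => ⨆ t ∈ Icc (δ n) (1 - δ n),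
        ‖WSpline.modifiedEstimate q (lam₁ n (Y n ω)) n (Y n ω) t - f t‖ₑ)
      (fun n : ℕ => (Real.log n) ^ (7 / 32 : ℝ) * (n : ℝ) ^ (-(11 / 32) : ℝ)) := by
  intro ε hε
  have hW : ∀ n, IsGaussianNoise μ (Finset.Icc 1 n) (Z n) := fun n => ⟨hZ_law n, hZ_indep n⟩
  have hYfun : ∀ n ω, Y n ω = fun i => f (design n i) + σ * Z n i ω := fun n ω =>
    funext fun i => hY n ω i
  obtain ⟨F, hF⟩ : ∃ F, ∀ t ∈ Icc (0 : ℝ) 1, ‖f t‖ ≤ F := by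
    obtain ⟨h, -, f₁, hf₁, -⟩ := hf
    exact isCompact_Icc.exists_bound_of_continuousOn fun t ht => (hf₁ t ht).continuousWithinAt
  set R := roughness f with hRdef
  have hR : 0 ≤ R := roughness_nonneg f
  set c := 400 * (R + 1) / σ ^ 2 with hc
  have hc0 : 0 < c := by positivity
  obtain ⟨C, hC0, hC⟩ := exists_sum_roughness_le hc0
  -- Constants for which the last two exceptional events have probability at most `ε / 5`.
  set M₁ := √(80 * (F ^ 2 + σ ^ 2) / ε) with hM₁
  have hM₁0 : 0 < M₁ := Real.sqrt_pos.2 (by positivity)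
  set M₂ := 5 * C / ε with hM₂
  have hM₂0 : 0 < M₂ := by positivity
  set A := 1.4826 / √2 * M₁ * √3 + 1.5 * σ with hA
  have hA0 : 0 < A := by positivity
  set B := 6 * R + 4 * σ ^ 2 * M₂ with hB
  have hB0 : 0 ≤ B := by positivity
  refine ⟨2 * A + 3 * √B, by positivity, ?_⟩
  filter_upwards [hC, eventually_union_bound_le (by positivity : 0 < ε / 5),
    hδ.eventually_ge_atTop 2, eventually_log_rpow_le (5 / 4) (s := 1 / 4) (by norm_num) one_pos,
    eventually_ge_atTop 3, eventually_ge_atTop (⌈150000 / ε⌉₊ + 3)] with n hCn hun hδn hρn hn hn2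
  have hn' : (3 : ℝ) ≤ n := by exact_mod_cast hn
  have hn0 : (0 : ℝ) < n := by linarith
  have hnpos : 0 < n := by omega
  set L := Real.log n with hLdef
  have hL : 1 ≤ L := by
    rw [hLdef, Real.le_log_iff_exp_le hn0]
    exact Real.exp_one_lt_d9.le.trans (by linarith)
  have hL0 : 0 < L := by linarith
  set lam := c / L with hlamdef
  have hlam : 0 < lam := div_pos hc0 hL0
  set x := 1.5 * √L with hx
  have hx0 : 0 ≤ x := by positivity
  set ρ := (n : ℝ) ^ (1 / 4 : ℝ) * L ^ (-(5 / 4) : ℝ) with hρ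
  have hρ1 : 1 ≤ ρ := by
    rw [one_mul] at hρn
    rw [hρ, Real.rpow_neg hL0.le, ← div_eq_mul_inv, one_le_div (by positivity)]
    exact hρn
  set Q := (n : ℝ) ^ (11 / 16 : ℝ) * L ^ (9 / 16 : ℝ) with hQ
  have hQ1 : 1 ≤ Q := one_le_mul_of_one_le_of_one_le
    (Real.one_le_rpow (by linarith) (by norm_num)) (Real.one_le_rpow hL (by norm_num))
  set r := L ^ (7 / 32 : ℝ) * (n : ℝ) ^ (-(11 / 32) : ℝ) with hr
  have hr0 : 0 ≤ r := by positivity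
  obtain ⟨k, hk1, hk2⟩ := exists_two_pow hQ1
  have hδQ : 2 * Q ≤ n * δ n := by
    have h1 := block_length_mul_eq hn0 hL0
    calc 2 * Q ≤ δ n * (n : ℝ) ^ (5 / 16 : ℝ) * L ^ (-(9 / 16) : ℝ) * Q := by gcongr
      _ = δ n * ((n : ℝ) ^ (5 / 16 : ℝ) * L ^ (-(9 / 16) : ℝ) * Q) := by ring
      _ = n * δ n := by rw [h1, mul_comm]
  have hBρ : 6 * R + 4 * σ ^ 2 * (M₂ * ρ) ≤ B * ρ := by
    have h1 : 6 * R * 1 ≤ 6 * R * ρ := by gcongr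
    calc 6 * R + 4 * σ ^ 2 * (M₂ * ρ) ≤ 6 * R * ρ + 4 * σ ^ 2 * (M₂ * ρ) := by linarith
      _ = B * ρ := by rw [hB]; ring
  -- The exceptional events.
  set E₁ := {ω | ¬ ∀ k m, |∑ j ∈ Finset.Icc 1 n,
    (if j ∈ block n k m then (1 : ℝ) else 0) * Z n j ω| ≤ x * √((block n k m).card : ℝ)} with hE₁
  set E₂ := {ω | ¬ ∀ k m, |∑ j ∈ Finset.Icc 1 n, residCoeff n lam (block n k m) j * Z n j ω| ≤
    x * √((block n k m).card : ℝ)} with hE₂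
  set E₃ := {ω | scaleEst n (fun i => f (design n i) + σ * Z n i ω) < 0.9 * σ} with hE₃
  set E₄ := {ω | 1.4826 / √2 * M₁ < scaleEst n (fun i => f (design n i) + σ * Z n i ω)} with hE₄
  set E₅ := {ω | M₂ * ρ ≤ roughness (fun t =>
    ∑ j ∈ Finset.Icc 1 n, Z n j ω * basisSpline n lam j t)} with hE₅
  have hP₁ : μ E₁ ≤ ENNReal.ofReal (ε / 5) :=
    ((hW n).measure_block_le hnpos (c := fun I j => if j ∈ I then (1 : ℝ) else 0)
      (fun I hI => (sum_indicator_sq hI).le) hx0).trans (ENNReal.ofReal_le_ofReal hun)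
  have hP₂ : μ E₂ ≤ ENNReal.ofReal (ε / 5) :=
    ((hW n).measure_block_le hnpos (c := residCoeff n lam)
      (fun I hI => sum_sq_residCoeff_le hlam hI) hx0).trans (ENNReal.ofReal_le_ofReal hun)
  have hP₃ : μ E₃ ≤ ENNReal.ofReal (ε / 5) := by
    refine ((hW n).measure_scaleEst_lt hn hσ _).trans (ENNReal.ofReal_le_ofReal ?_)
    have h1 : 150000 / ε ≤ ⌈150000 / ε⌉₊ := Nat.le_ceil _
    have h2 : (⌈150000 / ε⌉₊ : ℝ) + 3 ≤ n := by exact_mod_cast hn2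
    have h3 : 150000 / ε ≤ n - 2 := by linarith
    rw [div_le_iff₀ hε] at h3
    rw [div_le_div_iff₀ (by linarith) (by norm_num)]
    linarith
  have hP₄ : μ E₄ ≤ ENNReal.ofReal (ε / 5) := by
    refine ((hW n).measure_lt_scaleEst hn hM₁0 fun i hi => hF _ (design_mem hi)).trans
      (ENNReal.ofReal_le_ofReal (le_of_eq ?_))
    rw [hM₁, Real.sq_sqrt (by positivity)]
    field_simp
    norm_num
  have hP₅ : μ E₅ ≤ ENNReal.ofReal (ε / 5) := by
    refine ((hW n).measure_le_roughness_sum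
      (fun i _ => (isEqualSpline_basisSpline n hlam.le i).1) (by positivity)).trans
      (ENNReal.ofReal_le_ofReal ?_)
    rw [div_le_iff₀ (by positivity)]
    refine hCn.trans (le_of_eq ?_)
    rw [hM₂]
    field_simp
  have hsub : {ω | ENNReal.ofReal ((2 * A + 3 * √B) * r) < ⨆ t ∈ Icc (δ n) (1 - δ n),
      ‖modifiedEstimate q (lam₁ n (Y n ω)) n (Y n ω) t - f t‖ₑ} ⊆
      E₁ ∪ E₂ ∪ E₃ ∪ E₄ ∪ E₅ := by
    intro ω hω
    by_contra hgood
    simp only [mem_union, not_or] at hgood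
    obtain ⟨⟨⟨⟨h1, h2⟩, h3⟩, h4⟩, h5⟩ := hgood
    have h1 : ∀ k m, |∑ j ∈ Finset.Icc 1 n,
      (if j ∈ block n k m then (1 : ℝ) else 0) * Z n j ω| ≤ x * √((block n k m).card : ℝ) :=
      not_not.1 h1
    have h2 : ∀ k m, |∑ j ∈ Finset.Icc 1 n, residCoeff n lam (block n k m) j * Z n j ω| ≤
      x * √((block n k m).card : ℝ) := not_not.1 h2
    have h3 : 0.9 * σ ≤ scaleEst n (Y n ω) := by rw [hYfun]; exact not_lt.1 h3
    have h4 : scaleEst n (Y n ω) ≤ 1.4826 / √2 * M₁ := by rw [hYfun]; exact not_lt.1 h4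
    have h5 : roughness (fun t => ∑ j ∈ Finset.Icc 1 n, Z n j ω * basisSpline n lam j t) ≤
      M₂ * ρ := (not_le.1 h5).le
    have hT : threshold n (Y n ω) ≤ 1.4826 / √2 * M₁ * √3 * √L := by
      rw [threshold, Real.sqrt_mul (by norm_num), ← mul_assoc]
      gcongr
    refine (not_le.2 (mem_ofPred_eq ▸ hω)) (iSup₂_le fun t ht => ?_)
    rw [← ofReal_norm, Real.norm_eq_abs]
    refine ENNReal.ofReal_le_ofReal ?_
    have hntδ : n * δ n ≤ n * t := mul_le_mul_of_nonneg_left ht.1 hn0.le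
    have hntδ' : n * t ≤ n * (1 - δ n) := mul_le_mul_of_nonneg_left ht.2 hn0.le
    have hfin := abs_modifiedEstimate_sub_le hf hσ.le hlam (hY n ω) hnpos hx0
      (fun k m => by simpa only [sum_indicator_mul (block_subset n k m)] using h1 k m) h2 h5
      (bias_add_le_threshold hσ hR hL0 h3) hT (q := q) (l := lam₁ n (Y n ω)) (by linarith)
      (hlam₁ n _).le (k := k) (t := t) (by linarith) (by linarith)
    refine hfin.trans (le_trans ?_ (error_le hn0 (by positivity) hk1 hk2 hr0
      (mul_sq_rate_eq hn0 hL0) (cube_mul_eq hn0 hL0) hA0.le hB0 (by linarith)))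
    have e1 : 1.4826 / √2 * M₁ * √3 * √L + σ * x = A * √L := by rw [hA, hx]; ring
    rw [e1, ← hRdef]
    gcongr
  refine (measure_mono hsub).trans ?_
  have hsum : ENNReal.ofReal ε = ENNReal.ofReal (ε / 5) + ENNReal.ofReal (ε / 5) +
      ENNReal.ofReal (ε / 5) + ENNReal.ofReal (ε / 5) + ENNReal.ofReal (ε / 5) := by
    have h0 : 0 ≤ ε / 5 := by positivity
    rw [← ENNReal.ofReal_add h0 h0, ← ENNReal.ofReal_add (by positivity) h0,
      ← ENNReal.ofReal_add (by positivity) h0, ← ENNReal.ofReal_add (by positivity) h0]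
    congr 1
    ring
  rw [hsum]
  exact (measure_union_le _ _).trans (add_le_add ((measure_union_le _ _).trans (add_le_add
    ((measure_union_le _ _).trans (add_le_add ((measure_union_le _ _).trans
      (add_le_add hP₁ hP₂)) hP₃)) hP₄)) hP₅)
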